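/- Let $q$ be a prime power, let $V$ be a vector space of dimension $2\nu$ over the finite field $\mathbb F_q$, and let $f$ be a non-degenerate alternating bilinear form on $V$. For an integer $k\ge 0$ let $\mathcal P_k$ be the set of all $k$-dimensional subspaces $W$ of $V$ that are totally isotropic, i.e. $f(x,y)=0$ for all $x,y\in W$. A family $\mathcal F\subseteq\mathcal P_m$ is called $t$-intersecting if $\dim(F_1\cap F_2)\ge t$ for all $F_1,F_2\in\mathcal F$; it is called trivial if some fixed $t$-dimensional subspace of $V$ is contained in every member of $\mathcal F$, and non-trivial otherwise. For subspaces $T,U,Z$ of $V$ write $$\mathcal H_1(T,U)=\{F\in\mathcal P_m : T\subseteq F,\ \dim(F\cap U)\ge t\}\cup\{F\in\mathcal P_m : F\subseteq T+U\},$$ $$\mathcal H_2(Z)=\{F\in\mathcal P_m : \dim(F\cap Z)\ge t+1\}.$$ **Theorem.** Let $\nu,m,t$ be non-negative integers such that either $\nu\ge m+1=t+2$, or $2\nu\ge\max\{3m+2,\,2m+2t+6\}$ and $m\ge t+2$. Let $\mathcal F$ be a non-trivial $t$-intersecting subfamily of $\mathcal P_m$ of maximum size among all non-trivial $t$-intersecting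 subfamilies of $\mathcal P_m$. Then the following hold. (i) If $1\le t\le\frac m2-1$, then $\mathcal F=\mathcal H_1(T,U)$ for some $T\in\mathcal P_t$ and $U\in\mathcal P_m$ with $T+U\in\mathcal P_{m+1}$. (ii) If $\frac m2-1<t\le m-1$, then $\mathcal F=\mathcal H_2(Z)$ for some $Z\in\mathcal P_{t+2}$, or $(m,t)=(3,1)$ and $\mathcal F=\mathcal H_1(T,U)$ for some $T\in\mathcal P_1$ and $U\in\mathcal P_3$ with $T+U\in\mathcal P_4$. -/

import Mathlib

namespace SymplecticPolar

variable {K V : Type*} [Field K] [AddCommGroup V] [Module K V]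

/-- A subspace `W` is totally isotropic for the form `B` if `B x y = 0` for all `x, y ∈ W`. -/
def IsTotallyIsotropic (B : LinearMap.BilinForm K V) (W : Submodule K V) : Prop :=
  ∀ x ∈ W, ∀ y ∈ W, B x y = 0

/-- `𝒫_m`: the totally isotropic subspaces of dimension `m`. -/
def isotropicSubspaces (B : LinearMap.BilinForm K V) (m : ℕ) : Set (Submodule K V) :=
  {W | IsTotallyIsotropic B W ∧ Module.finrank K W = m}

/-- `dim (F₁ ∩ F₂) ≥ t` for all members `F₁, F₂` of the family. -/
def IsIntersecting (t : ℕ) (𝓕 : Set (Submodule K V)) : Prop :=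
  ∀ F₁ ∈ 𝓕, ∀ F₂ ∈ 𝓕, t ≤ Module.finrank K (F₁ ⊓ F₂ : Submodule K V)

/-- Some fixed `t`-dimensional subspace of `V` is contained in each member of the family. -/
def IsTrivialFamily (t : ℕ) (𝓕 : Set (Submodule K V)) : Prop :=
  ∃ T : Submodule K V, Module.finrank K T = t ∧ ∀ F ∈ 𝓕, T ≤ F

/-- Non-trivial `t`-intersecting subfamilies of `𝒫_m`. -/
def IsNontrivialIntersecting (B : LinearMap.BilinForm K V) (m t : ℕ)
    (𝓕 : Set (Submodule K V)) : Prop :=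
  𝓕 ⊆ isotropicSubspaces B m ∧ IsIntersecting t 𝓕 ∧ ¬ IsTrivialFamily t 𝓕

/-- Non-trivial `t`-intersecting subfamilies of `𝒫_m` of maximum size. It is used only for finite
`V`, where every family of subspaces is finite and `Set.ncard` is its number of members. -/
def IsMaximumNontrivialIntersecting (B : LinearMap.BilinForm K V) (m t : ℕ)
    (𝓕 : Set (Submodule K V)) : Prop :=
  IsNontrivialIntersecting B m t 𝓕 ∧
    ∀ 𝓖 : Set (Submodule K V), IsNontrivialIntersecting B m t 𝓖 → 𝓖.ncard ≤ 𝓕.ncard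

/-- `ℳ(m; A)`: the members of `𝒫_m` contained in `A`. -/
def isotropicIn (B : LinearMap.BilinForm K V) (m : ℕ) (A : Submodule K V) :
    Set (Submodule K V) :=
  {F | F ∈ isotropicSubspaces B m ∧ F ≤ A}

/-- `ℋ₁(T, U) = {F ∈ 𝒫_m : T ⊆ F, dim (F ∩ U) ≥ t} ∪ ℳ(m; T + U)`. -/
def familyH₁ (B : LinearMap.BilinForm K V) (m t : ℕ) (T U : Submodule K V) :
    Set (Submodule K V) :=
  {F | F ∈ isotropicSubspaces B m ∧ T ≤ F ∧ t ≤ Module.finrank K (F ⊓ U : Submodule K V)} ∪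
    isotropicIn B m (T ⊔ U)

/-- `ℋ₂(Z) = {F ∈ 𝒫_m : dim (F ∩ Z) ≥ t + 1}`. -/
def familyH₂ (B : LinearMap.BilinForm K V) (m t : ℕ) (Z : Submodule K V) :
    Set (Submodule K V) :=
  {F | F ∈ isotropicSubspaces B m ∧ t + 1 ≤ Module.finrank K (F ⊓ Z : Submodule K V)}

end SymplecticPolar

/-! ### q-integers -/

namespace SymplecticPolar

/-! Call a subspace a cover if it meets every member in dimension at least `t`. Let `t + j` be the
least dimension of a totally isotropic cover; non-triviality gives `j ≥ 1`. Write N(k) for the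
number of members of 𝒫_m through a totally isotropic k-space (`isoCount`) and [n] for `qInt q n`.
The quotient N(k)/N(k+1) is at least q^(2ν-m-k) (`pow_mul_isoCount_succ_le`), so high-dimensional
conditions are expensive. If W is not a cover, some member meets it too little, and each member
through W must contain one of at most [m-t+1] fixed one-step extensions of W
(`exists_extension_of_finrank_inf_lt`). When `j ≥ 2`, repeating this branching shows that the family
is too small.

When `j = 1`, maximality puts into the family every member of 𝒫_m through a cover, so the totally
isotropic covers of dimension t+1 pairwise meet in dimension at least t. Without a common t-space
they lie in one totally isotropic (t+2)-space Z (`exists_isotropic_of_pairwise`), and the family is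
ℋ₂(Z). Otherwise they share a t-space T and lie in T + F for each member F not through T. If they
span T + F the family is an ℋ₁; if not, there are too few covers and the family is again small.

The leading terms of |ℋ₁| and |ℋ₂| are [m-t+1]N(t+1) and [t+2]N(t+1), so the sign of m - (2t+1)
decides. At m = 2t+1 they tie; for t ≥ 2 the members meeting T + U in dimension at least t+2, which
the leading term of |ℋ₁| counts repeatedly, make ℋ₁ smaller (`lt_of_deep`). If m = t+1, the members
themselves play the role of the covers and no comparison of sizes is needed. -/

/-- The `q`-analogue `1 + q + ⋯ + q ^ (n - 1)` of the natural number `n`. -/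
def qInt (q n : ℕ) : ℕ := ∑ i ∈ Finset.range n, q ^ i

@[simp] lemma qInt_zero (q : ℕ) : qInt q 0 = 0 := by simp [qInt]

@[simp] lemma qInt_one (q : ℕ) : qInt q 1 = 1 := by simp [qInt]

lemma qInt_succ (q n : ℕ) : qInt q (n + 1) = qInt q n + q ^ n := by
  simp [qInt, Finset.sum_range_succ]

lemma qInt_succ' (q n : ℕ) : qInt q (n + 1) = q * qInt q n + 1 := by
  simp [qInt, Finset.sum_range_succ', pow_succ', Finset.mul_sum]

lemma qInt_add (q a b : ℕ) : qInt q (a + b) = qInt q a + q ^ a * qInt q b := by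
  induction b with
  | zero => simp
  | succ b ih => rw [← add_assoc, qInt_succ, ih, qInt_succ, pow_add]; ring

lemma qInt_mul_sub_one {q : ℕ} (hq : 1 ≤ q) (n : ℕ) : qInt q n * (q - 1) + 1 = q ^ n := by
  obtain ⟨p, rfl⟩ := Nat.exists_eq_add_of_le hq
  induction n with
  | zero => simp
  | succ n ih =>
    rw [qInt_succ, pow_succ, ← ih]
    simp only [Nat.add_sub_cancel_left] at ih ⊢
    nlinarith

lemma qInt_mono (q : ℕ) : Monotone (qInt q) := by
  refine monotone_nat_of_le_succ fun n => ?_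
  rw [qInt_succ]; omega

lemma qInt_pos {q n : ℕ} (hn : 0 < n) : 0 < qInt q n := by
  have := qInt_mono q (show 1 ≤ n from hn)
  rw [qInt_one] at this
  omega

lemma qInt_lt_pow {q : ℕ} (hq : 2 ≤ q) (n : ℕ) : qInt q n < q ^ n := by
  have h := qInt_mul_sub_one (show 1 ≤ q by omega) n
  have : qInt q n * 1 ≤ qInt q n * (q - 1) := Nat.mul_le_mul_left _ (by omega)
  omega

lemma qInt_succ_lt {q : ℕ} (hq : 2 ≤ q) (n : ℕ) : qInt q (n + 1) < 2 * q ^ n := by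
  rw [qInt_succ]
  have := qInt_lt_pow hq n
  omega

/-! ### Double counting -/

section DoubleCounting

variable {α β : Type*} [Finite α] [Finite β]

lemma ncard_mul_le_ncard_mul (A : Set α) (R : Set β) (rel : α → β → Prop) (x y : ℕ)
    (hA : ∀ a ∈ A, x ≤ {r | r ∈ R ∧ rel a r}.ncard)
    (hR : ∀ r ∈ R, {a | a ∈ A ∧ rel a r}.ncard ≤ y) : A.ncard * x ≤ R.ncard * y := by
  classical
  have := Fintype.ofFinite α
  have := Fintype.ofFinite β
  rw [Set.ncard_eq_toFinset_card', Set.ncard_eq_toFinset_card']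
  refine Finset.card_mul_le_card_mul rel (fun a ha => ?_) (fun r hr => ?_)
  · refine (hA a (by simpa using ha)).trans (le_of_eq ?_)
    rw [Set.ncard_eq_toFinset_card']
    congr 1; ext; simp [Finset.bipartiteAbove]
  · refine le_trans (le_of_eq ?_) (hR r (by simpa using hr))
    rw [Set.ncard_eq_toFinset_card']
    congr 1; ext; simp [Finset.bipartiteBelow]

lemma ncard_mul_eq_ncard_mul (A : Set α) (R : Set β) (rel : α → β → Prop) (x y : ℕ)
    (hA : ∀ a ∈ A, {r | r ∈ R ∧ rel a r}.ncard = x)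
    (hR : ∀ r ∈ R, {a | a ∈ A ∧ rel a r}.ncard = y) : A.ncard * x = R.ncard * y :=
  le_antisymm
    (ncard_mul_le_ncard_mul A R rel x y (fun a ha => (hA a ha).ge) fun r hr => (hR r hr).le)
    (ncard_mul_le_ncard_mul R A (fun r a => rel a r) y x (fun r hr => (hR r hr).ge)
      fun a ha => (hA a ha).le)

lemma ncard_le_mul_of_cover (A : Set α) (R : Set β) (rel : α → β → Prop) (y : ℕ)
    (hA : ∀ a ∈ A, ∃ r ∈ R, rel a r)
    (hR : ∀ r ∈ R, {a | a ∈ A ∧ rel a r}.ncard ≤ y) : A.ncard ≤ R.ncard * y := by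
  simpa using ncard_mul_le_ncard_mul A R rel 1 y (fun a ha => by
    obtain ⟨r, hr, h⟩ := hA a ha
    exact (Set.ncard_pos (Set.toFinite _)).2 ⟨r, hr, h⟩) hR

lemma mul_le_ncard_of_disjoint (A : Set α) (R : Set β) (rel : α → β → Prop) (x : ℕ)
    (hA : ∀ a ∈ A, ∀ r ∈ R, ∀ r' ∈ R, rel a r → rel a r' → r = r')
    (hR : ∀ r ∈ R, x ≤ {a | a ∈ A ∧ rel a r}.ncard) : R.ncard * x ≤ A.ncard := by
  simpa using ncard_mul_le_ncard_mul R A (fun r a => rel a r) x 1 hR (fun a ha => by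
    rw [Set.ncard_le_one (Set.toFinite _)]
    rintro r ⟨hr, h⟩ r' ⟨hr', h'⟩
    exact hA a ha r hr r' hr' h h')

end DoubleCounting

/-! ### Counting subspaces between two given ones -/

open Module

variable {K V : Type*} [Field K] [AddCommGroup V] [Module K V]

lemma finite_submodule [Finite K] [FiniteDimensional K V] : Finite (Submodule K V) := by
  have : Finite V := Module.finite_of_finite K
  exact Finite.of_injective (fun W : Submodule K V => (W : Set V)) SetLike.coe_injective

/-- The submodules between `A` and `M` of dimension `d`. -/
def between (A M : Submodule K V) (d : ℕ) : Set (Submodule K V) :=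
  {R | A ≤ R ∧ R ≤ M ∧ finrank K R = d}

lemma between_eq_of_le {A M R : Submodule K V} {d : ℕ} (hRM : R ≤ M) :
    {S | S ∈ between A M d ∧ S ≤ R} = between A R d := by
  ext S
  exact ⟨fun h => ⟨h.1.1, h.2, h.1.2.2⟩, fun h => ⟨⟨h.1, h.2.1.trans hRM, h.2.2⟩, h.2.1⟩⟩

variable [FiniteDimensional K V]

lemma finrank_sup_span_singleton_of_notMem {A : Submodule K V} {v : V} (hv : v ∉ A) :
    finrank K (A ⊔ K ∙ v : Submodule K V) = finrank K A + 1 :=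
  Submodule.finrank_sup_span_singleton hv

lemma eq_sup_span_singleton {A R : Submodule K V} {v : V} (hAR : A ≤ R)
    (hR : finrank K R = finrank K A + 1) (hvR : v ∈ R) (hvA : v ∉ A) : A ⊔ K ∙ v = R :=
  Submodule.eq_of_le_of_finrank_le
    (sup_le hAR ((Submodule.span_singleton_le_iff_mem _ _).2 hvR))
    (by rw [finrank_sup_span_singleton_of_notMem hvA, hR])

lemma exists_between {A M : Submodule K V} (h : A ≤ M) {d : ℕ} (hd : finrank K A ≤ d)
    (hd' : d ≤ finrank K M) : ∃ R, A ≤ R ∧ R ≤ M ∧ finrank K R = d := by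
  induction d, hd using Nat.le_induction with
  | base => exact ⟨A, le_rfl, h, rfl⟩
  | succ d hd ih =>
    obtain ⟨R, hAR, hRM, rfl⟩ := ih (by omega)
    obtain ⟨v, hvM, hvR⟩ := SetLike.exists_of_lt
      (lt_of_le_of_ne hRM (by rintro rfl; omega))
    exact ⟨R ⊔ K ∙ v, hAR.trans le_sup_left,
      sup_le hRM ((Submodule.span_singleton_le_iff_mem _ _).2 hvM),
      finrank_sup_span_singleton_of_notMem hvR⟩

variable [Finite K]

lemma ncard_coe_diff {A M : Submodule K V} (h : A ≤ M) :
    ((M : Set V) \ A).ncard = Nat.card K ^ finrank K M - Nat.card K ^ finrank K A := by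
  have : Finite V := Module.finite_of_finite K
  rw [Set.ncard_sdiff h (Set.toFinite _)]
  simp only [← Module.natCard_eq_pow_finrank, Set.ncard_def, Set.encard, ENat.card]
  rfl

/-- Each vector of `M` outside `A` lies in exactly one such `R`, namely `A ⊔ K ∙ v`, and every `R`
accounts for the same number of these vectors. -/
lemma ncard_between_succ {A M : Submodule K V} (h : A ≤ M) :
    (between A M (finrank K A + 1)).ncard = qInt (Nat.card K) (finrank K M - finrank K A) := by
  have : Finite V := Module.finite_of_finite K
  have := finite_submodule (K := K) (V := V)
  have hq : 2 ≤ Nat.card K := Finite.one_lt_card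
  obtain ⟨b, hb⟩ := Nat.exists_eq_add_of_le (Submodule.finrank_mono h)
  have key := ncard_mul_eq_ncard_mul ((M : Set V) \ A) (between A M (finrank K A + 1))
    (fun v R => v ∈ R) 1 (Nat.card K ^ (finrank K A + 1) - Nat.card K ^ finrank K A) ?_ ?_
  · rw [mul_one, ncard_coe_diff h, hb, Nat.add_sub_cancel_left] at *
    have h1 := qInt_mul_sub_one (show 1 ≤ Nat.card K by omega) b
    set q := Nat.card K
    set N := (between A M (finrank K A + 1)).ncard
    have hpos : 0 < q ^ finrank K A := by positivity
    rw [pow_add, pow_succ, ← Nat.mul_sub_one, ← Nat.mul_sub_one, mul_left_comm] at key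
    have := Nat.eq_of_mul_eq_mul_left hpos key
    have h3 : N * (q - 1) = qInt q b * (q - 1) := by omega
    exact Nat.eq_of_mul_eq_mul_right (by omega) h3
  · rintro v ⟨hvM, hvA⟩
    rw [Set.ncard_eq_one]
    refine ⟨A ⊔ K ∙ v, Set.eq_singleton_iff_unique_mem.2 ⟨⟨⟨le_sup_left,
      sup_le h ((Submodule.span_singleton_le_iff_mem _ _).2 hvM),
      finrank_sup_span_singleton_of_notMem hvA⟩,
      Submodule.mem_sup_right (Submodule.mem_span_singleton_self v)⟩, ?_⟩⟩
    rintro R ⟨⟨hAR, -, hR⟩, hvR⟩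
    exact (eq_sup_span_singleton hAR hR hvR hvA).symm
  · rintro R ⟨hAR, hRM, hR⟩
    rw [← hR, ← ncard_coe_diff hAR]
    congr 1
    ext v
    simp only [Set.mem_sdiff, SetLike.mem_coe, Set.mem_ofPred_eq]
    exact ⟨fun h => ⟨h.2, h.1.2⟩, fun h => ⟨⟨hRM h.1, h.2⟩, h.1⟩⟩

/-- Double counting of flags `A < R ≤ S ≤ M`. -/
lemma ncard_between_mul {A M : Submodule K V} (h : A ≤ M) {k b : ℕ}
    (hb : ∀ R ∈ between A M (finrank K A + 1), (between R M (finrank K A + (k + 1))).ncard = b) :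
    (between A M (finrank K A + (k + 1))).ncard * qInt (Nat.card K) (k + 1) =
      qInt (Nat.card K) (finrank K M - finrank K A) * b := by
  have := finite_submodule (K := K) (V := V)
  rw [← ncard_between_succ h]
  refine ncard_mul_eq_ncard_mul _ _ (fun S R => R ≤ S) _ _ ?_ ?_
  · rintro S ⟨hAS, hSM, hS⟩
    rw [between_eq_of_le hSM, ncard_between_succ hAS, hS, Nat.add_sub_cancel_left]
  · intro R hR
    rw [← hb R hR]
    congr 1
    ext S
    exact ⟨fun h => ⟨h.2, h.1.2⟩, fun h => ⟨⟨hR.1.trans h.1, h.2⟩, h.1⟩⟩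

lemma ncard_between_hyperplane {n : ℕ} : ∀ {A M : Submodule K V}, A ≤ M →
    finrank K M = finrank K A + (n + 1) →
    (between A M (finrank K A + n)).ncard = qInt (Nat.card K) (n + 1) := by
  have := finite_submodule (K := K) (V := V)
  induction n with
  | zero =>
    intro A M h hn
    rw [qInt_one, Set.ncard_eq_one]
    refine ⟨A, Set.eq_singleton_iff_unique_mem.2 ⟨⟨le_rfl, h, rfl⟩, ?_⟩⟩
    rintro R ⟨hAR, -, hR⟩
    exact (Submodule.eq_of_le_of_finrank_eq hAR (by omega)).symm
  | succ n ih =>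
    intro A M h hn
    have key := ncard_between_mul h (k := n) (b := qInt (Nat.card K) (n + 1)) ?_
    · rw [hn, Nat.add_sub_cancel_left] at key
      exact Nat.eq_of_mul_eq_mul_right (qInt_pos (Nat.succ_pos n)) key
    · rintro R ⟨-, hRM, hR⟩
      have := ih hRM (by omega)
      rwa [hR, show finrank K A + 1 + n = finrank K A + (n + 1) by ring] at this

lemma ncard_between_two {A M : Submodule K V} (h : A ≤ M) {n : ℕ}
    (hn : finrank K M = finrank K A + (n + 1)) :
    (between A M (finrank K A + 2)).ncard * (Nat.card K + 1) =
      qInt (Nat.card K) (n + 1) * qInt (Nat.card K) n := by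
  have := ncard_between_mul h (k := 1) (b := qInt (Nat.card K) n) ?_
  · rwa [hn, Nat.add_sub_cancel_left, qInt_succ', qInt_one, mul_one] at this
  · rintro R ⟨-, hRM, hR⟩
    have := ncard_between_succ hRM
    rwa [hR, hn, show finrank K A + (n + 1) - (finrank K A + 1) = n by omega] at this

/-- A crude bound for the q-binomial coefficient. Pass to a hyperplane of `S` and double count: each
step costs the ratio [t+j+1]/[j+1] ≤ 2q^t. -/
lemma ncard_between_bot_le (t : ℕ) : ∀ (j : ℕ) (S : Submodule K V), finrank K S = t + j →
    (between ⊥ S t).ncard ≤ (2 * Nat.card K ^ t) ^ j := by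
  have := finite_submodule (K := K) (V := V)
  have hq : 2 ≤ Nat.card K := Finite.one_lt_card
  intro j
  induction j with
  | zero =>
    intro S hS
    rw [pow_zero, Set.ncard_le_one (Set.toFinite _)]
    rintro A ⟨-, hA, hA'⟩ B ⟨-, hB, hB'⟩
    rw [Submodule.eq_of_le_of_finrank_eq hA (by omega),
      Submodule.eq_of_le_of_finrank_eq hB (by omega)]
  | succ j ih =>
    intro S hS
    have key := ncard_mul_le_ncard_mul (between ⊥ S t) (between ⊥ S (t + j))
      (fun T R => T ≤ R) (qInt (Nat.card K) (j + 1)) ((2 * Nat.card K ^ t) ^ j) ?_ ?_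
    · have h1 : (between ⊥ S (t + j)).ncard = qInt (Nat.card K) (t + j + 1) := by
        have := ncard_between_hyperplane (n := t + j) (bot_le : ⊥ ≤ S) (by rw [hS]; simp; rfl)
        simpa using this
      rw [h1] at key
      have h2 : qInt (Nat.card K) (t + j + 1) ≤ 2 * Nat.card K ^ t * qInt (Nat.card K) (j + 1) := by
        rw [add_assoc, qInt_add]
        have h3 := qInt_lt_pow hq t
        have h4 : 0 < qInt (Nat.card K) (j + 1) := qInt_pos (Nat.succ_pos j)
        nlinarith
      refine Nat.le_of_mul_le_mul_right (key.trans ?_) (qInt_pos (q := Nat.card K) (Nat.succ_pos j))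
      calc _ ≤ 2 * Nat.card K ^ t * qInt (Nat.card K) (j + 1) * (2 * Nat.card K ^ t) ^ j :=
            Nat.mul_le_mul_right _ h2
        _ = _ := by rw [pow_succ]; ring
    · rintro T ⟨-, hTS, hT⟩
      have := ncard_between_hyperplane (n := j) hTS (by omega)
      rw [← this, hT]
      refine Set.ncard_le_ncard ?_ (Set.toFinite _)
      rintro R ⟨h1, h2, h3⟩
      exact ⟨⟨bot_le, h2, h3⟩, h1⟩
    · rintro R ⟨-, hRS, hR⟩
      rw [between_eq_of_le hRS]
      exact ih R hR
  
end SymplecticPolar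

/-! ### Totally isotropic subspaces and their number -/

namespace SymplecticPolar
open Module

variable {K V : Type*} [Field K] [AddCommGroup V] [Module K V] {B : LinearMap.BilinForm K V}

lemma IsTotallyIsotropic.mono {W R : Submodule K V} (hR : IsTotallyIsotropic B R) (h : W ≤ R) :
    IsTotallyIsotropic B W := fun x hx y hy => hR x (h hx) y (h hy)

lemma IsTotallyIsotropic.le_orthogonal {W R : Submodule K V} (hR : IsTotallyIsotropic B R)
    (h : W ≤ R) : R ≤ B.orthogonal W := fun x hx y hy => hR y (h hy) x hx

lemma isTotallyIsotropic_bot : IsTotallyIsotropic B ⊥ := by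
  intro x hx y hy
  rw [(Submodule.mem_bot K).1 hx]; simp

lemma IsTotallyIsotropic.sup (hB : B.IsAlt) {W R : Submodule K V} (hW : IsTotallyIsotropic B W)
    (hR : IsTotallyIsotropic B R) (h : ∀ x ∈ W, ∀ y ∈ R, B x y = 0) :
    IsTotallyIsotropic B (W ⊔ R) := by
  intro x hx y hy
  obtain ⟨a, ha, b, hb, rfl⟩ := Submodule.mem_sup.1 hx
  obtain ⟨c, hc, d, hd, rfl⟩ := Submodule.mem_sup.1 hy
  have h1 := hB.isRefl _ _ (h c hc b hb)
  simp [hW a ha c hc, h a ha d hd, h1, hR b hb d hd]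

lemma isTotallyIsotropic_span_singleton (hB : B.IsAlt) (v : V) :
    IsTotallyIsotropic B (K ∙ v) := by
  intro x hx y hy
  obtain ⟨a, rfl⟩ := Submodule.mem_span_singleton.1 hx
  obtain ⟨b, rfl⟩ := Submodule.mem_span_singleton.1 hy
  simp [hB v]

lemma IsTotallyIsotropic.sup_span_singleton (hB : B.IsAlt) {W : Submodule K V}
    (hW : IsTotallyIsotropic B W) {v : V} (hv : v ∈ B.orthogonal W) :
    IsTotallyIsotropic B (W ⊔ K ∙ v) := by
  refine hW.sup hB (isTotallyIsotropic_span_singleton hB v) fun x hx y hy => ?_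
  obtain ⟨b, rfl⟩ := Submodule.mem_span_singleton.1 hy
  simp [show B x v = 0 from hv x hx]

/-- The members of `𝒫_m` containing `W`. -/
def isotropicThrough (B : LinearMap.BilinForm K V) (m : ℕ) (W : Submodule K V) :
    Set (Submodule K V) :=
  {F | F ∈ isotropicSubspaces B m ∧ W ≤ F}

/-- The number of `m`-dimensional totally isotropic subspaces of a `2ν`-dimensional symplectic
space over a field with `q` elements containing a given one of dimension `m - j`. -/
def isoCountAux (q ν m : ℕ) : ℕ → ℕ
  | 0 => 1
  | j + 1 => qInt q (2 * ν - 2 * (m - (j + 1))) * isoCountAux q ν m j / qInt q (j + 1)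

/-- The number of `m`-dimensional totally isotropic subspaces of a `2ν`-dimensional symplectic
space over a field with `q` elements containing a given `k`-dimensional one. -/
def isoCount (q ν m k : ℕ) : ℕ := if k ≤ m then isoCountAux q ν m (m - k) else 0

@[simp] lemma isoCount_self (q ν m : ℕ) : isoCount q ν m m = 1 := by simp [isoCount, isoCountAux]

lemma isoCount_of_lt {q ν m k : ℕ} (h : m < k) : isoCount q ν m k = 0 := by
  simp [isoCount, h]

variable [FiniteDimensional K V] {ν m : ℕ}

lemma finrank_orthogonal_eq (hB : B.Nondegenerate) (hdim : finrank K V = 2 * ν)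
    (W : Submodule K V) : finrank K (B.orthogonal W) = 2 * ν - finrank K W := by
  rw [← hdim, LinearMap.BilinForm.finrank_orthogonal hB]

/-- The form is alternating, so adjoining any vector of the orthogonal of `W` keeps `W` isotropic:
one-step isotropic extensions are the points of W^⊥/W. -/
lemma mem_between_orthogonal (hB : B.IsAlt) {W : Submodule K V} (hW : IsTotallyIsotropic B W)
    {R : Submodule K V} : R ∈ between W (B.orthogonal W) (finrank K W + 1) ↔
      W ≤ R ∧ IsTotallyIsotropic B R ∧ finrank K R = finrank K W + 1 := by
  refine ⟨fun ⟨h1, h2, h3⟩ => ⟨h1, ?_, h3⟩, fun ⟨h1, h2, h3⟩ => ⟨h1, h2.le_orthogonal h1, h3⟩⟩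
  obtain ⟨v, hvR, hvW⟩ := SetLike.exists_of_lt (lt_of_le_of_ne h1 (by rintro rfl; omega))
  rw [← eq_sup_span_singleton h1 h3 hvR hvW]
  exact hW.sup_span_singleton hB (h2 hvR)

lemma IsTotallyIsotropic.exists_succ (hBa : B.IsAlt) (hB : B.Nondegenerate)
    (hdim : finrank K V = 2 * ν) {W : Submodule K V} (hW : IsTotallyIsotropic B W)
    (h : finrank K W < ν) :
    ∃ R, W ≤ R ∧ IsTotallyIsotropic B R ∧ finrank K R = finrank K W + 1 := by
  obtain ⟨R, h1, h2, h3⟩ := exists_between (hW.le_orthogonal le_rfl) (d := finrank K W + 1)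
    (by omega) (by rw [finrank_orthogonal_eq hB hdim]; omega)
  exact ⟨R, (mem_between_orthogonal hBa hW).1 ⟨h1, h2, h3⟩⟩

lemma IsTotallyIsotropic.exists_ge (hBa : B.IsAlt) (hB : B.Nondegenerate)
    (hdim : finrank K V = 2 * ν) {W : Submodule K V} (hW : IsTotallyIsotropic B W) {d : ℕ}
    (hd : finrank K W ≤ d) (h : d ≤ ν) : ∃ R, W ≤ R ∧ R ∈ isotropicSubspaces B d := by
  induction d, hd using Nat.le_induction with
  | base => exact ⟨W, le_rfl, hW, rfl⟩
  | succ d hd ih =>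
    obtain ⟨R, hWR, hR, rfl⟩ := ih (by omega)
    obtain ⟨S, hRS, hS, hS'⟩ := hR.exists_succ hBa hB hdim (by omega)
    exact ⟨S, hWR.trans hRS, hS, hS'⟩

lemma exists_isotropic (hBa : B.IsAlt) (hB : B.Nondegenerate)
    (hdim : finrank K V = 2 * ν) {d : ℕ} (h : d ≤ ν) : ∃ R, R ∈ isotropicSubspaces B d := by
  obtain ⟨R, -, hR⟩ := isTotallyIsotropic_bot.exists_ge hBa hB hdim (d := d) (by simp) h
  exact ⟨R, hR⟩

variable [Finite K]

/-- Double count the pairs `R ≤ F` with `R` a one-step extension of `W`; W^⊥/W has dimension 2ν - 2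
dim W. -/
lemma ncard_isotropicThrough_mul (hBa : B.IsAlt) (hB : B.Nondegenerate)
    (hdim : finrank K V = 2 * ν) {W : Submodule K V} (hW : IsTotallyIsotropic B W) {c : ℕ}
    (hc : ∀ R, W ≤ R → IsTotallyIsotropic B R → finrank K R = finrank K W + 1 →
      (isotropicThrough B m R).ncard = c) :
    (isotropicThrough B m W).ncard * qInt (Nat.card K) (m - finrank K W) =
      qInt (Nat.card K) (2 * ν - 2 * finrank K W) * c := by
  have := finite_submodule (K := K) (V := V)
  have h1 := ncard_between_succ (hW.le_orthogonal le_rfl)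
  rw [finrank_orthogonal_eq hB hdim, show 2 * ν - finrank K W - finrank K W =
    2 * ν - 2 * finrank K W by omega] at h1
  rw [← h1]
  refine ncard_mul_eq_ncard_mul _ _ (fun F R => R ≤ F) _ _ ?_ ?_
  · rintro F ⟨⟨hF, hFm⟩, hWF⟩
    rw [between_eq_of_le (hF.le_orthogonal hWF), ncard_between_succ hWF, hFm]
  · intro R hR
    obtain ⟨hWR, hR, hRd⟩ := (mem_between_orthogonal hBa hW).1 hR
    rw [← hc R hWR hR hRd]
    congr 1
    ext F
    exact ⟨fun h => ⟨h.1.1, h.2⟩, fun h => ⟨⟨h.1, hWR.trans h.2⟩, h.2⟩⟩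

lemma ncard_isotropicThrough_aux (hBa : B.IsAlt) (hB : B.Nondegenerate)
    (hdim : finrank K V = 2 * ν) (j : ℕ) : ∀ {W : Submodule K V}, IsTotallyIsotropic B W →
    finrank K W + j = m → (isotropicThrough B m W).ncard = isoCountAux (Nat.card K) ν m j := by
  induction j with
  | zero =>
    intro W hW hj
    rw [isoCountAux, Set.ncard_eq_one]
    refine ⟨W, Set.eq_singleton_iff_unique_mem.2 ⟨⟨⟨hW, by omega⟩, le_rfl⟩, ?_⟩⟩
    rintro R ⟨⟨-, hR⟩, hWR⟩
    exact (Submodule.eq_of_le_of_finrank_eq hWR (by omega)).symm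
  | succ j ih =>
    intro W hW hj
    have key := ncard_isotropicThrough_mul hBa hB hdim hW (m := m)
      (c := isoCountAux (Nat.card K) ν m j) fun R _ hR hRd => ih hR (by omega)
    rw [isoCountAux]
    rw [show m - finrank K W = j + 1 by omega] at key
    -- The double count shows that the division in `isoCountAux` is exact.
    rw [show m - (j + 1) = finrank K W by omega, ← key,
      Nat.mul_div_cancel _ (qInt_pos (Nat.succ_pos j))]

lemma ncard_isotropicThrough (hBa : B.IsAlt) (hB : B.Nondegenerate)
    (hdim : finrank K V = 2 * ν) {W : Submodule K V} (hW : IsTotallyIsotropic B W) :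
    (isotropicThrough B m W).ncard = isoCount (Nat.card K) ν m (finrank K W) := by
  have := finite_submodule (K := K) (V := V)
  rw [isoCount]
  split_ifs with h
  · exact ncard_isotropicThrough_aux hBa hB hdim _ hW (by omega)
  · rw [Set.ncard_eq_zero (Set.toFinite _), Set.eq_empty_iff_forall_notMem]
    rintro F ⟨⟨-, hF⟩, hWF⟩
    have := Submodule.finrank_mono hWF
    omega

lemma ncard_isotropicThrough_le (hBa : B.IsAlt) (hB : B.Nondegenerate)
    (hdim : finrank K V = 2 * ν) (W : Submodule K V) :
    (isotropicThrough B m W).ncard ≤ isoCount (Nat.card K) ν m (finrank K W) := by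
  have := finite_submodule (K := K) (V := V)
  by_cases hW : IsTotallyIsotropic B W
  · exact (ncard_isotropicThrough hBa hB hdim hW).le
  · have : isotropicThrough B m W = ∅ := by
      rw [Set.eq_empty_iff_forall_notMem]
      rintro F ⟨⟨hF, -⟩, hWF⟩
      exact hW (hF.mono hWF)
    simp [this]

/-- The ratio of the two counts is [2ν-2k]/[m-k] for k < m, and [a+b] ≥ q^a [b] with b = m-k. All
later size comparisons rest on this ratio. -/
lemma pow_mul_isoCount_succ_le (hBa : B.IsAlt) (hB : B.Nondegenerate)
    (hdim : finrank K V = 2 * ν) (hm : m ≤ ν) (k : ℕ) :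
    Nat.card K ^ (2 * ν - m - k) * isoCount (Nat.card K) ν m (k + 1) ≤
      isoCount (Nat.card K) ν m k := by
  have hq : 2 ≤ Nat.card K := Finite.one_lt_card
  rcases lt_or_ge k m with hk | hk
  · obtain ⟨W, hW, rfl⟩ := exists_isotropic hBa hB hdim (show k ≤ ν by omega)
    have key := ncard_isotropicThrough_mul hBa hB hdim hW (m := m) fun R _ hR hRd => by
      rw [ncard_isotropicThrough hBa hB hdim hR, hRd]
    rw [ncard_isotropicThrough hBa hB hdim hW] at key
    refine Nat.le_of_mul_le_mul_right ?_
      (qInt_pos (q := Nat.card K) (show 0 < m - finrank K W by omega))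
    rw [key, show 2 * ν - 2 * finrank K W =
      (2 * ν - m - finrank K W) + (m - finrank K W) by omega, qInt_add]
    nlinarith [Nat.zero_le (qInt (Nat.card K) (2 * ν - m - finrank K W) *
      isoCount (Nat.card K) ν m (finrank K W + 1))]
  · rw [isoCount_of_lt (by omega)]; simp

lemma isoCount_pos (hBa : B.IsAlt) (hB : B.Nondegenerate)
    (hdim : finrank K V = 2 * ν) (hm : m ≤ ν) {k : ℕ} (hk : k ≤ m) :
    0 < isoCount (Nat.card K) ν m k := by
  have hq : 2 ≤ Nat.card K := Finite.one_lt_card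
  induction hk using Nat.decreasingInduction with
  | self => simp
  | of_succ k hk ih =>
    exact lt_of_lt_of_le (by positivity) (pow_mul_isoCount_succ_le hBa hB hdim hm k)

/-- Most totally isotropic subspaces through `S` meet `M` only in `S`. -/
lemma isoCount_le_ncard_inf_eq_add (hBa : B.IsAlt) (hB : B.Nondegenerate)
    (hdim : finrank K V = 2 * ν) {S M : Submodule K V} (hS : IsTotallyIsotropic B S)
    (hSM : S ≤ M) :
    isoCount (Nat.card K) ν m (finrank K S) ≤
      {F | F ∈ isotropicSubspaces B m ∧ F ⊓ M = S}.ncard +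
        qInt (Nat.card K) (finrank K M - finrank K S) *
          isoCount (Nat.card K) ν m (finrank K S + 1) := by
  have := finite_submodule (K := K) (V := V)
  rw [← ncard_isotropicThrough hBa hB hdim hS, ← ncard_between_succ hSM]
  have h1 : {F | F ∈ isotropicThrough B m S ∧ F ⊓ M ≠ S}.ncard ≤
      (between S M (finrank K S + 1)).ncard * isoCount (Nat.card K) ν m (finrank K S + 1) := by
    refine ncard_le_mul_of_cover _ _ (fun F R => R ≤ F) _ ?_ ?_
    · rintro F ⟨⟨hF, hSF⟩, hne⟩
      obtain ⟨v, ⟨hvF, hvM⟩, hvS⟩ := SetLike.exists_of_lt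
        (lt_of_le_of_ne (le_inf hSF hSM) (Ne.symm hne))
      exact ⟨S ⊔ K ∙ v, ⟨le_sup_left,
        sup_le hSM ((Submodule.span_singleton_le_iff_mem _ _).2 hvM),
        finrank_sup_span_singleton_of_notMem hvS⟩,
        sup_le hSF ((Submodule.span_singleton_le_iff_mem _ _).2 hvF)⟩
    · rintro R ⟨-, -, hR⟩
      rw [← hR]
      refine le_trans (Set.ncard_le_ncard ?_ (Set.toFinite _))
        (ncard_isotropicThrough_le hBa hB hdim R)
      rintro F ⟨⟨h, -⟩, hR⟩
      exact ⟨h.1, hR⟩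
  have h2 : isotropicThrough B m S ⊆ {F | F ∈ isotropicSubspaces B m ∧ F ⊓ M = S} ∪
      {F | F ∈ isotropicThrough B m S ∧ F ⊓ M ≠ S} := by
    intro F hF
    by_cases h : F ⊓ M = S
    · exact Or.inl ⟨hF.1, h⟩
    · exact Or.inr ⟨hF, h⟩
  have h3 := (Set.ncard_le_ncard h2 (Set.toFinite _)).trans (Set.ncard_union_le _ _)
  omega

end SymplecticPolar

/-! ### Covers and the branching bound -/

namespace SymplecticPolar
open Module

variable {K V : Type*} [Field K] [AddCommGroup V] [Module K V] {B : LinearMap.BilinForm K V}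

/-- `S` meets all members of the family in dimension at least `t`. -/
def IsCover (t : ℕ) (𝓕 : Set (Submodule K V)) (S : Submodule K V) : Prop :=
  ∀ F ∈ 𝓕, t ≤ finrank K (F ⊓ S : Submodule K V)

variable [FiniteDimensional K V] {ν m t : ℕ}

lemma le_finrank_inf_of_le {X Y M : Submodule K V} (hX : X ≤ M) (hY : Y ≤ M) :
    finrank K X + finrank K Y ≤ finrank K M + finrank K (X ⊓ Y : Submodule K V) := by
  rw [← Submodule.finrank_sup_add_finrank_inf_eq X Y]
  exact Nat.add_le_add_right (Submodule.finrank_mono (sup_le hX hY)) _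

/-- Choose `G` in `F₀` above `F₀ ⊓ W` with m-t+1 extra dimensions. If `F` meets `F₀` in dimension at
least `t`, it meets `G` in more than `F₀ ⊓ W`, hence contains a vector of `G` outside `W`; take `M =
W ⊔ G`. -/
lemma exists_extension_of_finrank_inf_lt {W F₀ : Submodule K V} (hF₀ : finrank K F₀ = m)
    (htm : t ≤ m) (h : finrank K (F₀ ⊓ W : Submodule K V) < t) :
    ∃ M, W ≤ M ∧ finrank K M = finrank K W + (m - t + 1) ∧ ∀ F, W ≤ F →
      t ≤ finrank K (F₀ ⊓ F : Submodule K V) → ∃ R ∈ between W M (finrank K W + 1), R ≤ F := by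
  obtain ⟨G, hG₁, hG₂, hG⟩ := exists_between (inf_le_left : F₀ ⊓ W ≤ F₀)
    (d := m - t + 1 + finrank K (F₀ ⊓ W : Submodule K V)) (by omega) (by omega)
  have hGW : G ⊓ W = F₀ ⊓ W :=
    le_antisymm (inf_le_inf_right _ hG₂) (le_inf hG₁ inf_le_right)
  refine ⟨W ⊔ G, le_sup_left, ?_, fun F hWF hF => ?_⟩
  · have := Submodule.finrank_sup_add_finrank_inf_eq W G
    rw [inf_comm, hGW] at this
    omega
  · have h1 := le_finrank_inf_of_le (inf_le_left : F₀ ⊓ F ≤ F₀) hG₂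
    have h2 : ¬ F₀ ⊓ F ⊓ G ≤ F₀ ⊓ W := fun h => by
      have := Submodule.finrank_mono h
      omega
    obtain ⟨v, ⟨⟨hv₀, hvF⟩, hvG⟩, hv⟩ := SetLike.not_le_iff_exists.1 h2
    have hvW : v ∉ W := fun hvW => hv ⟨hv₀, hvW⟩
    exact ⟨W ⊔ K ∙ v, ⟨le_sup_left, sup_le_sup_left
      ((Submodule.span_singleton_le_iff_mem _ _).2 hvG) _,
      finrank_sup_span_singleton_of_notMem hvW⟩,
      sup_le hWF ((Submodule.span_singleton_le_iff_mem _ _).2 hvF)⟩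

variable [Finite K]

lemma ncard_le_qInt_mul {W F₀ : Submodule K V} (hF₀ : finrank K F₀ = m)
    (htm : t ≤ m) (h : finrank K (F₀ ⊓ W : Submodule K V) < t) {𝓖 : Set (Submodule K V)}
    (h𝓖 : ∀ F ∈ 𝓖, W ≤ F ∧ t ≤ finrank K (F₀ ⊓ F : Submodule K V)) {y : ℕ}
    (hy : ∀ R, W ≤ R → finrank K R = finrank K W + 1 → {F | F ∈ 𝓖 ∧ R ≤ F}.ncard ≤ y) :
    𝓖.ncard ≤ qInt (Nat.card K) (m - t + 1) * y := by
  have := finite_submodule (K := K) (V := V)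
  obtain ⟨M, hWM, hM, hR⟩ := exists_extension_of_finrank_inf_lt hF₀ htm h
  have h1 := ncard_between_succ hWM
  rw [hM, Nat.add_sub_cancel_left] at h1
  rw [← h1]
  exact ncard_le_mul_of_cover _ _ (fun F R => R ≤ F) _
    (fun F hF => hR F (h𝓖 F hF).1 (h𝓖 F hF).2) fun R hR => hy R hR.1 hR.2.2

lemma ncard_subfamily_le (hBa : B.IsAlt) (hB : B.Nondegenerate) (hdim : finrank K V = 2 * ν)
    {𝓖 : Set (Submodule K V)} (h𝓖 : 𝓖 ⊆ isotropicSubspaces B m) (R : Submodule K V) :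
    {F | F ∈ 𝓖 ∧ R ≤ F}.ncard ≤ isoCount (Nat.card K) ν m (finrank K R) := by
  have := finite_submodule (K := K) (V := V)
  exact (Set.ncard_le_ncard (t := isotropicThrough B m R)
    (fun F hF => ⟨h𝓖 hF.1, hF.2⟩) (Set.toFinite _)).trans (ncard_isotropicThrough_le hBa hB hdim R)

lemma ncard_subfamily_le_of_not_isCover (hBa : B.IsAlt) (hB : B.Nondegenerate)
    (hdim : finrank K V = 2 * ν) {𝓕 : Set (Submodule K V)} (h𝓕 : 𝓕 ⊆ isotropicSubspaces B m)
    (hint : IsIntersecting t 𝓕) (htm : t ≤ m) {R : Submodule K V} (hR : ¬ IsCover t 𝓕 R) :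
    {F | F ∈ 𝓕 ∧ R ≤ F}.ncard ≤
      qInt (Nat.card K) (m - t + 1) * isoCount (Nat.card K) ν m (finrank K R + 1) := by
  rw [IsCover] at hR
  push Not at hR
  obtain ⟨F₀, hF₀, hlt⟩ := hR
  refine ncard_le_qInt_mul (h𝓕 hF₀).2 htm hlt (fun F hF => ⟨hF.2, hint _ hF₀ _ hF.1⟩)
    fun S _ hS => ?_
  rw [← hS]
  exact ncard_subfamily_le hBa hB hdim (fun F hF => h𝓕 hF.1) S

/-- An isotropic `R` of dimension below `s` is not a cover, so the branching step applies `j` times;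
an `R` that is not isotropic lies in no member. -/
lemma ncard_subfamily_le_pow_mul (hBa : B.IsAlt) (hB : B.Nondegenerate)
    (hdim : finrank K V = 2 * ν) {𝓕 : Set (Submodule K V)} (h𝓕 : 𝓕 ⊆ isotropicSubspaces B m)
    (hint : IsIntersecting t 𝓕) (htm : t ≤ m) {s : ℕ}
    (hs : ∀ S, IsTotallyIsotropic B S → IsCover t 𝓕 S → s ≤ finrank K S) (j : ℕ) :
    ∀ R : Submodule K V, finrank K R + j = s → {F | F ∈ 𝓕 ∧ R ≤ F}.ncard ≤
      qInt (Nat.card K) (m - t + 1) ^ j * isoCount (Nat.card K) ν m s := by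
  have := finite_submodule (K := K) (V := V)
  induction j with
  | zero =>
    rintro R rfl
    simpa using ncard_subfamily_le hBa hB hdim h𝓕 R
  | succ j ih =>
    intro R hR
    by_cases hiso : IsTotallyIsotropic B R
    · have hcov : ¬ IsCover t 𝓕 R := fun h => by have := hs R hiso h; omega
      rw [IsCover] at hcov
      push Not at hcov
      obtain ⟨F₀, hF₀, hlt⟩ := hcov
      rw [pow_succ', mul_assoc]
      refine ncard_le_qInt_mul (h𝓕 hF₀).2 htm hlt (fun F hF => ⟨hF.2, hint _ hF₀ _ hF.1⟩)
        fun S _ hS => ?_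
      exact (Set.ncard_le_ncard (t := {F | F ∈ 𝓕 ∧ S ≤ F})
        (fun F hF => ⟨hF.1.1, hF.2⟩) (Set.toFinite _)).trans (ih S (by omega))
    · have : {F | F ∈ 𝓕 ∧ R ≤ F} = ∅ := by
        rw [Set.eq_empty_iff_forall_notMem]
        rintro F ⟨hF, hRF⟩
        exact hiso ((h𝓕 hF).1.mono hRF)
      simp [this]

lemma ncard_le_of_isCover {𝓖 : Set (Submodule K V)} {S : Submodule K V} (hS : IsCover t 𝓖 S)
    {y : ℕ} (hy : ∀ T ≤ S, finrank K T = t → {F | F ∈ 𝓖 ∧ T ≤ F}.ncard ≤ y) :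
    𝓖.ncard ≤ (between ⊥ S t).ncard * y := by
  have := finite_submodule (K := K) (V := V)
  refine ncard_le_mul_of_cover _ _ (fun F T => T ≤ F) _ (fun F hF => ?_) fun T hT =>
    hy T hT.2.1 hT.2.2
  obtain ⟨T, -, hT, hTt⟩ := exists_between (bot_le : ⊥ ≤ F ⊓ S) (d := t) (by simp) (hS F hF)
  exact ⟨T, ⟨bot_le, hT.trans inf_le_right, hTt⟩, hT.trans inf_le_left⟩

lemma ncard_le_of_min_isCover (hBa : B.IsAlt) (hB : B.Nondegenerate)
    (hdim : finrank K V = 2 * ν) {𝓕 : Set (Submodule K V)} (h𝓕 : 𝓕 ⊆ isotropicSubspaces B m)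
    (hint : IsIntersecting t 𝓕) (htm : t ≤ m) {j : ℕ}
    (hs : ∀ S, IsTotallyIsotropic B S → IsCover t 𝓕 S → t + j ≤ finrank K S)
    {S : Submodule K V} (hS : IsCover t 𝓕 S) (hSd : finrank K S = t + j) :
    𝓕.ncard ≤ (2 * Nat.card K ^ t) ^ j *
      (qInt (Nat.card K) (m - t + 1) ^ j * isoCount (Nat.card K) ν m (t + j)) :=
  (ncard_le_of_isCover hS fun T _ hT =>
    ncard_subfamily_le_pow_mul hBa hB hdim h𝓕 hint htm hs j T (by omega)).trans
    (Nat.mul_le_mul_right _ (ncard_between_bot_le t j S hSd))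

/-- The first summand bounds the members containing a (t+1)-cover. The others contain no such cover,
so two branching steps apply, starting at `T` or, for members not through `T`, at one of the [t+1]
`t`-spaces of `S`. -/
lemma ncard_le_of_covers_through (hBa : B.IsAlt) (hB : B.Nondegenerate)
    (hdim : finrank K V = 2 * ν) {𝓕 : Set (Submodule K V)} (h𝓕 : 𝓕 ⊆ isotropicSubspaces B m)
    (hint : IsIntersecting t 𝓕) (hnt : ¬ IsTrivialFamily t 𝓕) (htm : t ≤ m)
    {T S M : Submodule K V} (hT : finrank K T = t) (hTM : T ≤ M)
    (hS : IsCover t 𝓕 S) (hSd : finrank K S = t + 1)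
    (hcov : ∀ R, IsTotallyIsotropic B R → IsCover t 𝓕 R → finrank K R = t + 1 → T ≤ R ∧ R ≤ M) :
    𝓕.ncard ≤ qInt (Nat.card K) (finrank K M - t) * isoCount (Nat.card K) ν m (t + 1) +
      (1 + qInt (Nat.card K) (t + 1)) * (qInt (Nat.card K) (m - t + 1) *
        (qInt (Nat.card K) (m - t + 1) * isoCount (Nat.card K) ν m (t + 2))) := by
  have := finite_submodule (K := K) (V := V)
  set q := Nat.card K
  -- A `t`-dimensional cover would lie in every member, making the family trivial.
  have hnc : ∀ W : Submodule K V, finrank K W = t →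
      ∃ F ∈ 𝓕, finrank K (F ⊓ W : Submodule K V) < t := by
    intro W hW
    by_contra! hc
    refine hnt ⟨W, hW, fun F hF => ?_⟩
    rw [← Submodule.eq_of_le_of_finrank_le (inf_le_right : F ⊓ W ≤ W) (by rw [hW]; exact hc F hF)]
    exact inf_le_left
  -- the members that contain a cover
  have h1 : {F | F ∈ 𝓕 ∧ ∃ R ∈ between T M (finrank K T + 1), R ≤ F}.ncard ≤
      qInt q (finrank K M - t) * isoCount q ν m (t + 1) := by
    rw [← hT, ← ncard_between_succ hTM]
    refine ncard_le_mul_of_cover _ _ (fun F R => R ≤ F) _ (fun F hF => hF.2) fun R hR => ?_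
    rw [← hR.2.2]
    exact ncard_subfamily_le hBa hB hdim (fun F hF => h𝓕 hF.1) R
  -- the members through a `t`-space that contain no cover
  have h2 : ∀ W : Submodule K V, finrank K W = t → ∀ 𝓖 : Set (Submodule K V), 𝓖 ⊆ 𝓕 →
      (∀ F ∈ 𝓖, W ≤ F) →
      (∀ F ∈ 𝓖, ∀ R, R ≤ F → finrank K R = t + 1 → ¬ IsCover t 𝓕 R) →
      𝓖.ncard ≤ qInt q (m - t + 1) * (qInt q (m - t + 1) * isoCount q ν m (t + 2)) := by
    intro W hW 𝓖 h𝓖 hW𝓖 hno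
    obtain ⟨F₀, hF₀, hlt⟩ := hnc W hW
    refine ncard_le_qInt_mul (h𝓕 hF₀).2 htm hlt
      (fun F hF => ⟨hW𝓖 F hF, hint _ hF₀ _ (h𝓖 hF)⟩) fun R hWR hR => ?_
    by_cases hRc : IsCover t 𝓕 R
    · have : {F | F ∈ 𝓖 ∧ R ≤ F} = ∅ := by
        rw [Set.eq_empty_iff_forall_notMem]
        exact fun F hF => hno F hF.1 R hF.2 (by omega) hRc
      simp [this]
    · have := ncard_subfamily_le_of_not_isCover hBa hB hdim h𝓕 hint htm hRc
      rw [hR, hW] at this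
      exact (Set.ncard_le_ncard (t := {F | F ∈ 𝓕 ∧ R ≤ F})
        (fun F hF => ⟨h𝓖 hF.1, hF.2⟩) (Set.toFinite _)).trans this
  have h3 : {F | F ∈ 𝓕 ∧ T ≤ F ∧ ∀ R, R ≤ F → finrank K R = t + 1 → ¬ IsCover t 𝓕 R}.ncard ≤
      qInt q (m - t + 1) * (qInt q (m - t + 1) * isoCount q ν m (t + 2)) :=
    h2 T hT _ (fun F hF => hF.1) (fun F hF => hF.2.1) fun F hF => hF.2.2
  have h4 : {F | F ∈ 𝓕 ∧ ¬ T ≤ F}.ncard ≤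
      qInt q (t + 1) * (qInt q (m - t + 1) * (qInt q (m - t + 1) * isoCount q ν m (t + 2))) := by
    have hb := ncard_between_hyperplane (n := t) (bot_le : ⊥ ≤ S) (by rw [hSd]; simp)
    rw [finrank_bot, zero_add] at hb
    rw [← hb]
    refine ncard_le_of_isCover (fun F hF => hS F hF.1) fun W _ hW => ?_
    refine h2 W hW _ (fun F hF => hF.1.1) (fun F hF => hF.2) fun F hF R hRF hR hRc => ?_
    exact hF.1.2 ((hcov R ((h𝓕 hF.1.1).1.mono hRF) hRc hR).1.trans hRF)
  have h5 : 𝓕 ⊆ ({F | F ∈ 𝓕 ∧ ∃ R ∈ between T M (finrank K T + 1), R ≤ F} ∪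
      {F | F ∈ 𝓕 ∧ T ≤ F ∧ ∀ R, R ≤ F → finrank K R = t + 1 → ¬ IsCover t 𝓕 R}) ∪
      {F | F ∈ 𝓕 ∧ ¬ T ≤ F} := by
    intro F hF
    by_cases hTF : T ≤ F
    · left
      by_cases h : ∀ R, R ≤ F → finrank K R = t + 1 → ¬ IsCover t 𝓕 R
      · exact Or.inr ⟨hF, hTF, h⟩
      · push Not at h
        obtain ⟨R, hRF, hR, hRc⟩ := h
        have := hcov R ((h𝓕 hF).1.mono hRF) hRc hR
        exact Or.inl ⟨hF, R, ⟨this.1, this.2, by omega⟩, hRF⟩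
    · exact Or.inr ⟨hF, hTF⟩
  have h6 := (Set.ncard_le_ncard h5 (Set.toFinite _)).trans (Set.ncard_union_le _ _)
  have h7 := Set.ncard_union_le {F | F ∈ 𝓕 ∧ ∃ R ∈ between T M (finrank K T + 1), R ≤ F}
    {F | F ∈ 𝓕 ∧ T ≤ F ∧ ∀ R, R ≤ F → finrank K R = t + 1 → ¬ IsCover t 𝓕 R}
  rw [add_mul, one_mul]
  omega

end SymplecticPolar

/-! ### The two examples and consequences of maximality -/

namespace SymplecticPolar
open Module

variable {K V : Type*} [Field K] [AddCommGroup V] [Module K V] {B : LinearMap.BilinForm K V}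
variable [FiniteDimensional K V] {ν m t : ℕ}

/-- The members of `𝒫_m` that contain `T` and meet `M` in dimension more than `t`, and those that
are contained in `M`. -/
def pencilFamily (B : LinearMap.BilinForm K V) (m t : ℕ) (T M : Submodule K V) :
    Set (Submodule K V) :=
  {F | F ∈ isotropicSubspaces B m ∧ T ≤ F ∧ t + 1 ≤ finrank K (F ⊓ M : Submodule K V)} ∪
    isotropicIn B m M

lemma finrank_inf_eq_of_lt {X S Z : Submodule K V} (hSZ : S ≤ Z)
    (hS : t ≤ finrank K (X ⊓ S : Submodule K V)) (hZ : finrank K (X ⊓ Z : Submodule K V) < t + 1) :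
    X ⊓ S = X ⊓ Z :=
  Submodule.eq_of_le_of_finrank_le (inf_le_inf_left X hSZ) (by omega)

/-- `U` is a hyperplane of `T ⊔ U`, so passing to it loses at most one dimension. Conversely, no
loss at dimension `t` would force `T ≤ U`. -/
lemma familyH₁_eq_pencilFamily {T U : Submodule K V} (hU : finrank K U = m)
    (hTU : finrank K (T ⊔ U : Submodule K V) = m + 1) :
    familyH₁ B m t T U = pencilFamily B m t T (T ⊔ U) := by
  have hnTU : ¬ T ≤ U := fun h => by rw [sup_eq_right.2 h] at hTU; omega
  have key : ∀ F : Submodule K V, T ≤ F → (t ≤ finrank K (F ⊓ U : Submodule K V) ↔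
      t + 1 ≤ finrank K (F ⊓ (T ⊔ U) : Submodule K V)) := by
    intro F hTF
    constructor
    · intro h
      by_contra! hlt
      have := finrank_inf_eq_of_lt (le_sup_right : U ≤ T ⊔ U) h hlt
      exact hnTU ((le_inf hTF le_sup_left).trans (this.symm.le.trans inf_le_right))
    · intro h
      have h1 := le_finrank_inf_of_le (inf_le_right : F ⊓ (T ⊔ U) ≤ T ⊔ U)
        (le_sup_right : U ≤ T ⊔ U)
      rw [inf_assoc, inf_eq_right.2 (le_sup_right : U ≤ T ⊔ U)] at h1
      omega
  ext F
  refine or_congr ⟨fun ⟨h1, h2, h3⟩ => ⟨h1, h2, (key F h2).1 h3⟩,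
    fun ⟨h1, h2, h3⟩ => ⟨h1, h2, (key F h2).2 h3⟩⟩ Iff.rfl

/-- Used to show non-triviality: the hyperplanes of a space have no common nonzero vector. `v` need
not lie in `M`. -/
lemma exists_hyperplane_notMem {M : Submodule K V} {d : ℕ} (hM : finrank K M = d + 1) {v : V}
    (hv : v ≠ 0) : ∃ W ≤ M, finrank K W = d ∧ v ∉ W := by
  induction d generalizing M with
  | zero => exact ⟨⊥, bot_le, by simp, by simpa using hv⟩
  | succ d ih =>
    obtain ⟨M', -, hM', hM'd⟩ := exists_between (bot_le : ⊥ ≤ M) (d := d + 1) (by simp) (by omega)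
    obtain ⟨W, hWM', hW, hvW⟩ := ih hM'd
    by_cases hvM' : v ∈ M'
    · obtain ⟨u, huM, hu⟩ := SetLike.exists_of_lt (lt_of_le_of_ne hM' (by rintro rfl; omega))
      have huW : u ∉ W := fun h => hu (hWM' h)
      refine ⟨W ⊔ K ∙ u, sup_le (hWM'.trans hM')
        ((Submodule.span_singleton_le_iff_mem _ _).2 huM), by
        rw [finrank_sup_span_singleton_of_notMem huW, hW], fun h => ?_⟩
      obtain ⟨w, hw, z, hz, hwz⟩ := Submodule.mem_sup.1 h
      obtain ⟨a, rfl⟩ := Submodule.mem_span_singleton.1 hz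
      by_cases ha : a = 0
      · apply hvW
        rw [← hwz, ha, zero_smul, add_zero]
        exact hw
      · apply hu
        have : a • u ∈ M' := by
          rw [show a • u = v - w by rw [← hwz]; abel]
          exact M'.sub_mem hvM' (hWM' hw)
        simpa [ha] using M'.smul_mem a⁻¹ this
    · exact ⟨M', hM', hM'd, hvM'⟩

lemma isNontrivialIntersecting_pencilFamily {T M : Submodule K V} (ht : 1 ≤ t) (htm : t + 1 ≤ m)
    (hT : finrank K T = t) (hM : M ∈ isotropicSubspaces B (m + 1)) :
    IsNontrivialIntersecting B m t (pencilFamily B m t T M) := by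
  refine ⟨?_, ?_, ?_⟩
  · rintro F (hF | hF)
    exacts [hF.1, hF.1]
  · have key : ∀ F G : Submodule K V, t + 1 ≤ finrank K (F ⊓ M : Submodule K V) →
        finrank K G = m → G ≤ M → t ≤ finrank K (F ⊓ G : Submodule K V) := by
      intro F G hF hG hGM
      have h := le_finrank_inf_of_le (inf_le_right : F ⊓ M ≤ M) hGM
      rw [inf_assoc, inf_eq_right.2 hGM, hM.2] at h
      omega
    rintro F (hF | hF) G (hG | hG)
    · rw [← hT]
      exact Submodule.finrank_mono (le_inf hF.2.1 hG.2.1)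
    · exact key F G hF.2.2 hG.1.2 hG.2
    · rw [inf_comm]
      exact key G F hG.2.2 hF.1.2 hF.2
    · exact key F G (by rw [inf_eq_left.2 hF.2, hF.1.2]; omega) hG.1.2 hG.2
  · rintro ⟨T', hT', hle⟩
    obtain ⟨v, hv, hv0⟩ := (Submodule.ne_bot_iff T').1 (by rintro rfl; simp at hT'; omega)
    obtain ⟨W, hWM, hW, hvW⟩ := exists_hyperplane_notMem hM.2 hv0
    exact hvW (hle W (Or.inr ⟨⟨hM.1.mono hWM, hW⟩, hWM⟩) hv)

lemma le_of_two_subspaces {S A A' Z : Submodule K V} (hS : finrank K S = t + 1) (hA : A ≤ S)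
    (hA' : A' ≤ S) (hAd : t ≤ finrank K A) (hAd' : t ≤ finrank K A') (hne : ¬ A ≤ A' ∨ ¬ A' ≤ A)
    (hAZ : A ≤ Z) (hAZ' : A' ≤ Z) : A ⊔ A' = S ∧ S ≤ Z := by
  have h : A ⊔ A' = S := by
    refine Submodule.eq_of_le_of_finrank_le (sup_le hA hA') ?_
    rw [hS]
    by_contra! hlt
    have h1 : A = A ⊔ A' := Submodule.eq_of_le_of_finrank_le le_sup_left (by omega)
    have h2 : A' = A ⊔ A' := Submodule.eq_of_le_of_finrank_le le_sup_right (by omega)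
    rcases hne with h | h
    · exact h (by rw [h2]; exact le_sup_left)
    · exact h (by rw [h1]; exact le_sup_right)
  exact ⟨h, h ▸ sup_le hAZ hAZ'⟩

/-- Totally isotropic `(t + 1)`-spaces pairwise meeting in dimension `t` that have no `t`-space in
common lie in a totally isotropic `(t + 2)`-space. -/
lemma exists_isotropic_of_pairwise (hBa : B.IsAlt) {𝒮 : Set (Submodule K V)}
    (hne : 𝒮.Nonempty) (h𝒮 : 𝒮 ⊆ isotropicSubspaces B (t + 1)) (hint : IsIntersecting t 𝒮)
    (hnt : ¬ IsTrivialFamily t 𝒮) :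
    ∃ Z ∈ isotropicSubspaces B (t + 2), ∀ X : Submodule K V,
      (∀ S ∈ 𝒮, t ≤ finrank K (X ⊓ S : Submodule K V)) →
        t + 1 ≤ finrank K (X ⊓ Z : Submodule K V) := by
  obtain ⟨S₁, hS₁⟩ := hne
  have hd₁ := (h𝒮 hS₁).2
  obtain ⟨S₂, hS₂, hne₁₂⟩ : ∃ S₂ ∈ 𝒮, ¬ S₁ ≤ S₂ := by
    by_contra! hc
    obtain ⟨T, -, hT, hTd⟩ := exists_between (bot_le : ⊥ ≤ S₁) (d := t) (by simp) (by omega)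
    exact hnt ⟨T, hTd, fun F hF => hT.trans (hc F hF)⟩
  have hd₂ := (h𝒮 hS₂).2
  have hT : finrank K (S₁ ⊓ S₂ : Submodule K V) = t := by
    refine le_antisymm ?_ (hint _ hS₁ _ hS₂)
    by_contra! hlt
    exact hne₁₂ (inf_eq_left.1 (Submodule.eq_of_le_of_finrank_le inf_le_left (by omega)))
  obtain ⟨S₃, hS₃, hne₃⟩ : ∃ S₃ ∈ 𝒮, ¬ S₁ ⊓ S₂ ≤ S₃ := by
    by_contra! hc
    exact hnt ⟨_, hT, hc⟩
  have hd₃ := (h𝒮 hS₃).2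
  set Z := S₁ ⊔ S₂
  -- Such an `S` meets `S₁` and `S₂` in distinct subspaces of dimension at least `t`, which span it.
  have hout : ∀ S ∈ 𝒮, ¬ S₁ ⊓ S₂ ≤ S → S₁ ⊓ S ⊔ S₂ ⊓ S = S ∧ S ≤ Z := by
    intro S hS hTS
    have h1 := hint _ hS₁ _ hS
    have h2 := hint _ hS₂ _ hS
    refine le_of_two_subspaces (h𝒮 hS).2 inf_le_right inf_le_right h1 h2 (Or.inl fun hle => ?_)
      (inf_le_left.trans le_sup_left) (inf_le_left.trans le_sup_right)
    have h3 : S₁ ⊓ S ≤ S₁ ⊓ S₂ := le_inf inf_le_left (hle.trans inf_le_left)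
    have h4 := Submodule.eq_of_le_of_finrank_le h3 (by omega)
    exact hTS (h4.symm.le.trans inf_le_right)
  have hin : ∀ S ∈ 𝒮, S₁ ⊓ S₂ ≤ S → S₁ ⊓ S₂ ⊔ S₃ ⊓ S = S ∧ S ≤ Z := by
    intro S hS hTS
    exact le_of_two_subspaces (h𝒮 hS).2 hTS inf_le_right hT.ge (hint _ hS₃ _ hS)
      (Or.inl fun hle => hne₃ (hle.trans inf_le_left)) (inf_le_left.trans le_sup_left)
      (inf_le_left.trans (hout S₃ hS₃ hne₃).2)
  have hall : ∀ S ∈ 𝒮, S ≤ Z := fun S hS =>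
    (em (S₁ ⊓ S₂ ≤ S)).elim (fun h => (hin S hS h).2) fun h => (hout S hS h).2
  -- Each of `S₁`, `S₂` is spanned by `S₁ ⊓ S₂` and its intersection with `S₃`; isotropy of the
  -- three spaces handles every cross term.
  have hiso : ∀ x ∈ S₁, ∀ y ∈ S₂, B x y = 0 := by
    intro x hx y hy
    rw [← (hin S₁ hS₁ inf_le_left).1] at hx
    rw [← (hin S₂ hS₂ inf_le_right).1] at hy
    obtain ⟨a, ha, b, hb, rfl⟩ := Submodule.mem_sup.1 hx
    obtain ⟨c, hc, d, hd, rfl⟩ := Submodule.mem_sup.1 hy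
    have i₁ := (h𝒮 hS₁).1
    have i₂ := (h𝒮 hS₂).1
    have i₃ := (h𝒮 hS₃).1
    simp [i₁ a ha.1 c hc.1, i₂ a ha.2 d hd.2, i₁ b hb.2 c hc.1, i₃ b hb.1 d hd.1]
  refine ⟨Z, ⟨(h𝒮 hS₁).1.sup hBa (h𝒮 hS₂).1 hiso, ?_⟩, fun X hX => ?_⟩
  · have := Submodule.finrank_sup_add_finrank_inf_eq S₁ S₂
    change finrank K (S₁ ⊔ S₂ : Submodule K V) = t + 2
    omega
  · by_contra! hlt
    -- If `X` met `Z` in dimension at most `t`, all the `X ⊓ S` would equal `X ⊓ Z`, a common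
    -- `t`-space.
    have heq : ∀ S ∈ 𝒮, X ⊓ S = X ⊓ Z := fun S hS => finrank_inf_eq_of_lt (hall S hS) (hX S hS) hlt
    refine hnt ⟨X ⊓ Z, le_antisymm (by omega) ?_, fun S hS => ?_⟩
    · exact (hX S₁ hS₁).trans (Submodule.finrank_mono (inf_le_inf_left X (hall S₁ hS₁)))
    · rw [← heq S hS]
      exact inf_le_right

variable [Finite K]

lemma isNontrivialIntersecting_familyH₂ (hBa : B.IsAlt) (hB : B.Nondegenerate)
    (hdim : finrank K V = 2 * ν) {Z : Submodule K V} (ht : 1 ≤ t)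
    (hlt : isoCount (Nat.card K) ν m (t + 2) < isoCount (Nat.card K) ν m (t + 1))
    (hZ : Z ∈ isotropicSubspaces B (t + 2)) :
    IsNontrivialIntersecting B m t (familyH₂ B m t Z) := by
  have := finite_submodule (K := K) (V := V)
  refine ⟨fun F hF => hF.1, fun F hF G hG => ?_, ?_⟩
  · have h := le_finrank_inf_of_le (inf_le_right : F ⊓ Z ≤ Z) (inf_le_right : G ⊓ Z ≤ Z)
    have h1 := Submodule.finrank_mono (le_inf (inf_le_left.trans inf_le_left)
      (inf_le_right.trans inf_le_left) : (F ⊓ Z) ⊓ (G ⊓ Z) ≤ F ⊓ G)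
    rw [hZ.2] at h
    have := hF.2
    have := hG.2
    omega
  · rintro ⟨T', hT', hle⟩
    obtain ⟨v, hv, hv0⟩ := (Submodule.ne_bot_iff T').1 (by rintro rfl; simp at hT'; omega)
    obtain ⟨S, hSZ, hS, hvS⟩ := exists_hyperplane_notMem hZ.2 hv0
    -- Counting yields a member through the hyperplane `S` of `Z` that avoids `v`, so `v` is not
    -- common to the family.
    have h := isoCount_le_ncard_inf_eq_add (m := m) hBa hB hdim (hZ.1.mono hSZ)
      (le_sup_left : S ≤ S ⊔ K ∙ v)
    rw [finrank_sup_span_singleton_of_notMem hvS, Nat.add_sub_cancel_left, hS, qInt_one,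
      one_mul, show t + 1 + 1 = t + 2 from rfl] at h
    obtain ⟨F, hF, hFS⟩ := (Set.ncard_pos (Set.toFinite _)).1
      (show 0 < {F | F ∈ isotropicSubspaces B m ∧ F ⊓ (S ⊔ K ∙ v) = S}.ncard by omega)
    have hSF : S ≤ F := hFS.symm.le.trans inf_le_left
    have hFH : F ∈ familyH₂ B m t Z :=
      ⟨hF, by rw [← hS]; exact Submodule.finrank_mono (le_inf hSF hSZ)⟩
    apply hvS
    rw [← hFS]
    exact ⟨hle F hFH hv, Submodule.mem_sup_right (Submodule.mem_span_singleton_self v)⟩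

lemma IsMaximumNontrivialIntersecting.eq_of_subset {𝓕 𝓖 : Set (Submodule K V)}
    (h𝓕 : IsMaximumNontrivialIntersecting B m t 𝓕) (h𝓖 : IsNontrivialIntersecting B m t 𝓖)
    (h : 𝓕 ⊆ 𝓖) : 𝓕 = 𝓖 := by
  have := finite_submodule (K := K) (V := V)
  exact Set.eq_of_subset_of_ncard_le h (h𝓕.2 𝓖 h𝓖) (Set.toFinite _)

/-- Adjoining everything through a cover keeps the family `t`-intersecting and non-trivial, so
maximality says nothing new was adjoined. -/
lemma IsMaximumNontrivialIntersecting.mem_of_isCover {𝓕 : Set (Submodule K V)}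
    (h𝓕 : IsMaximumNontrivialIntersecting B m t 𝓕) {S : Submodule K V} (hS : IsCover t 𝓕 S)
    (hSd : t ≤ finrank K S) {G : Submodule K V} (hG : G ∈ isotropicSubspaces B m) (hSG : S ≤ G) :
    G ∈ 𝓕 := by
  have key : 𝓕 = 𝓕 ∪ isotropicThrough B m S := by
    refine h𝓕.eq_of_subset ⟨?_, ?_, ?_⟩ Set.subset_union_left
    · exact Set.union_subset h𝓕.1.1 fun F hF => hF.1
    · rintro F (hF | hF) F' (hF' | hF')
      · exact h𝓕.1.2.1 F hF F' hF'
      · exact (hS F hF).trans (Submodule.finrank_mono (inf_le_inf_left F hF'.2))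
      · rw [inf_comm]
        exact (hS F' hF').trans (Submodule.finrank_mono (inf_le_inf_left F' hF.2))
      · exact hSd.trans (Submodule.finrank_mono (le_inf hF.2 hF'.2))
    · rintro ⟨T, hT, h⟩
      exact h𝓕.1.2.2 ⟨T, hT, fun F hF => h F (Or.inl hF)⟩
  rw [key]
  exact Or.inr ⟨hG, hSG⟩

/-- The numerical hypothesis provides an `F` through `S` with `F ⊓ (S ⊔ S') = S`. It is a member, so
`S'` meets it in dimension at least `t`, and that intersection lies in `S`. -/
lemma IsMaximumNontrivialIntersecting.le_finrank_inf_of_isCover (hBa : B.IsAlt)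
    (hB : B.Nondegenerate) (hdim : finrank K V = 2 * ν) {𝓕 : Set (Submodule K V)}
    (h𝓕 : IsMaximumNontrivialIntersecting B m t 𝓕)
    (hlt : qInt (Nat.card K) (t + 1) * isoCount (Nat.card K) ν m (t + 2) <
      isoCount (Nat.card K) ν m (t + 1)) {S S' : Submodule K V}
    (hS : IsTotallyIsotropic B S) (hSc : IsCover t 𝓕 S) (hSd : finrank K S = t + 1)
    (hSc' : IsCover t 𝓕 S') (hSd' : finrank K S' = t + 1) :
    t ≤ finrank K (S ⊓ S' : Submodule K V) := by
  have := finite_submodule (K := K) (V := V)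
  have h := isoCount_le_ncard_inf_eq_add (m := m) hBa hB hdim hS (le_sup_left : S ≤ S ⊔ S')
  have h1 := Submodule.finrank_sup_add_finrank_inf_eq S S'
  have h2 := qInt_mono (Nat.card K) (show finrank K (S ⊔ S' : Submodule K V) - finrank K S ≤ t + 1
    by omega)
  have h3 := Nat.mul_le_mul_right (isoCount (Nat.card K) ν m (t + 2)) h2
  rw [hSd] at h h3
  rw [show t + 1 + 1 = t + 2 from rfl] at h
  obtain ⟨F, hF, hFS⟩ := (Set.ncard_pos (Set.toFinite _)).1
    (show 0 < {F | F ∈ isotropicSubspaces B m ∧ F ⊓ (S ⊔ S') = S}.ncard by omega)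
  have hSF : S ≤ F := hFS.symm.le.trans inf_le_left
  have h4 := hSc' F (h𝓕.mem_of_isCover hSc (by omega) hF hSF)
  refine h4.trans (Submodule.finrank_mono (le_inf ?_ inf_le_right))
  rw [← hFS]
  exact inf_le_inf_left F le_sup_right

end SymplecticPolar

/-! ### Structure of a maximum family -/

namespace SymplecticPolar
open Module

variable {K V : Type*} [Field K] [AddCommGroup V] [Module K V] {B : LinearMap.BilinForm K V}
variable [FiniteDimensional K V] {ν m t : ℕ}

/-- If all covers in `𝒮` pass through `T`, then they lie in `T ⊔ F`, for each member `F` that does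
not contain `T`. -/
lemma finrank_sup_of_isCover {𝓕 : Set (Submodule K V)} {T S F : Submodule K V}
    (hT : finrank K T = t) (hTS : T ≤ S) (hS : IsCover t 𝓕 S) (hSd : finrank K S = t + 1)
    (hF : F ∈ 𝓕) (hFm : finrank K F = m) (hTF : ¬ T ≤ F) :
    S ≤ T ⊔ F ∧ finrank K (T ⊔ F : Submodule K V) = m + 1 := by
  refine ⟨(le_of_two_subspaces hSd hTS (inf_le_right : F ⊓ S ≤ S) hT.ge (hS F hF)
    (Or.inl fun h => hTF (h.trans inf_le_left)) le_sup_left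
    (inf_le_left.trans le_sup_right)).2, ?_⟩
  have h1 := le_finrank_inf_of_le hTS (inf_le_right : F ⊓ S ≤ S)
  have h2 := Submodule.finrank_mono (inf_le_inf_left T (inf_le_left : F ⊓ S ≤ F))
  have h3 := hS F hF
  have h4 := Submodule.finrank_sup_add_finrank_inf_eq T F
  have h5 : finrank K (T ⊓ F : Submodule K V) < t := by
    by_contra! h
    exact hTF (inf_eq_left.1 (Submodule.eq_of_le_of_finrank_le inf_le_left (by omega)))
  omega

lemma IsNontrivialIntersecting.nonempty (hBa : B.IsAlt) (hB : B.Nondegenerate)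
    (hdim : finrank K V = 2 * ν) {𝓕 : Set (Submodule K V)}
    (h𝓕 : IsNontrivialIntersecting B m t 𝓕) (htν : t ≤ ν) : 𝓕.Nonempty := by
  by_contra! hc
  obtain ⟨T, hT⟩ := exists_isotropic hBa hB hdim htν
  exact h𝓕.2.2 ⟨T, hT.2, by simp [hc]⟩

variable [Finite K]

/-- The structure of a maximum family that has a cover of dimension `t + 1`. -/
lemma IsMaximumNontrivialIntersecting.structure_of_isCover (hBa : B.IsAlt) (hB : B.Nondegenerate)
    (hdim : finrank K V = 2 * ν) {𝓕 : Set (Submodule K V)}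
    (h𝓕 : IsMaximumNontrivialIntersecting B m t 𝓕) (ht : 1 ≤ t) (htm : t + 1 ≤ m)
    (hlt : qInt (Nat.card K) (t + 1) * isoCount (Nat.card K) ν m (t + 2) <
      isoCount (Nat.card K) ν m (t + 1)) {S₀ : Submodule K V} (hS₀ : IsTotallyIsotropic B S₀)
    (hSc₀ : IsCover t 𝓕 S₀) (hSd₀ : finrank K S₀ = t + 1) :
    (∃ Z ∈ isotropicSubspaces B (t + 2), 𝓕 = familyH₂ B m t Z) ∨
    (∃ T ∈ isotropicSubspaces B t, ∃ U ∈ isotropicSubspaces B m,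
      T ⊔ U ∈ isotropicSubspaces B (m + 1) ∧ 𝓕 = familyH₁ B m t T U) ∨
    𝓕.ncard ≤ qInt (Nat.card K) (m - t) * isoCount (Nat.card K) ν m (t + 1) +
      (1 + qInt (Nat.card K) (t + 1)) * (qInt (Nat.card K) (m - t + 1) *
        (qInt (Nat.card K) (m - t + 1) * isoCount (Nat.card K) ν m (t + 2))) := by
  set 𝒮 : Set (Submodule K V) := {S | S ∈ isotropicSubspaces B (t + 1) ∧ IsCover t 𝓕 S}
  by_cases htriv : IsTrivialFamily t 𝒮
  swap
  · left
    obtain ⟨Z, hZ, hX⟩ := exists_isotropic_of_pairwise hBa (𝒮 := 𝒮) ⟨S₀, ⟨hS₀, hSd₀⟩, hSc₀⟩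
      (fun S hS => hS.1) (fun S hS S' hS' => h𝓕.le_finrank_inf_of_isCover hBa hB hdim hlt
        hS.1.1 hS.2 hS.1.2 hS'.2 hS'.1.2) htriv
    refine ⟨Z, hZ, h𝓕.eq_of_subset
      (isNontrivialIntersecting_familyH₂ hBa hB hdim ht ?_ hZ)
      fun F hF => ⟨h𝓕.1.1 hF, hX F fun S hS => hS.2 F hF⟩⟩
    have := qInt_pos (q := Nat.card K) (Nat.succ_pos t)
    nlinarith
  · right
    obtain ⟨T, hT, hTS⟩ := htriv
    have hTS₀ : T ≤ S₀ := hTS S₀ ⟨⟨hS₀, hSd₀⟩, hSc₀⟩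
    obtain ⟨U, hU, hTU⟩ : ∃ U ∈ 𝓕, ¬ T ≤ U := by
      by_contra! hc
      exact h𝓕.1.2.2 ⟨T, hT, hc⟩
    have hTiso := hS₀.mono hTS₀
    have hM : ∀ F ∈ 𝓕, ¬ T ≤ F → sSup 𝒮 ≤ T ⊔ F ∧
        finrank K (T ⊔ F : Submodule K V) = m + 1 := fun F hF hTF =>
      ⟨sSup_le fun S hS => (finrank_sup_of_isCover hT (hTS S hS) hS.2 hS.1.2 hF
        (h𝓕.1.1 hF).2 hTF).1,
        (finrank_sup_of_isCover hT hTS₀ hSc₀ hSd₀ hF (h𝓕.1.1 hF).2 hTF).2⟩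
    have hTM : T ≤ sSup 𝒮 := hTS₀.trans (le_sSup ⟨⟨hS₀, hSd₀⟩, hSc₀⟩)
    -- If the covers span at most `m` dimensions, at most [m-t] of them pass through `T`, and the
    -- family is small. Otherwise their span equals `T ⊔ F` for every member `F` not through `T`.
    by_cases hMd : finrank K (sSup 𝒮 : Submodule K V) ≤ m
    · right
      refine (ncard_le_of_covers_through hBa hB hdim h𝓕.1.1 h𝓕.1.2.1 h𝓕.1.2.2 (by omega) hT hTM
        hSc₀ hSd₀ fun R hR hRc hRd => ⟨hTS R ⟨⟨hR, hRd⟩, hRc⟩, le_sSup ⟨⟨hR, hRd⟩, hRc⟩⟩).trans ?_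
      gcongr
      exact qInt_mono _ (by omega)
    · left
      have hMeq : ∀ F ∈ 𝓕, ¬ T ≤ F → sSup 𝒮 = T ⊔ F := fun F hF hTF =>
        Submodule.eq_of_le_of_finrank_le (hM F hF hTF).1 (by rw [(hM F hF hTF).2]; omega)
      have hTUiso : T ⊔ U ∈ isotropicSubspaces B (m + 1) := by
        refine ⟨hTiso.sup hBa (h𝓕.1.1 hU).1 fun x hx y hy => ?_, (hM U hU hTU).2⟩
        -- Isotropic covers containing `T` are orthogonal to `T`; their span contains `U`.
        have h1 : sSup 𝒮 ≤ B.orthogonal T :=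
          sSup_le fun S hS => hS.1.1.le_orthogonal (hTS S hS)
        exact h1 ((hMeq U hU hTU).symm.le ((le_sup_right : U ≤ T ⊔ U) hy)) x hx
      refine ⟨T, ⟨hTiso, hT⟩, U, h𝓕.1.1 hU, hTUiso, ?_⟩
      rw [familyH₁_eq_pencilFamily (h𝓕.1.1 hU).2 hTUiso.2]
      refine h𝓕.eq_of_subset (isNontrivialIntersecting_pencilFamily ht htm hT hTUiso)
        fun F hF => ?_
      by_cases hTF : T ≤ F
      · refine Or.inl ⟨h𝓕.1.1 hF, hTF, ?_⟩
        by_contra! hlt'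
        have := finrank_inf_eq_of_lt (le_sup_right : U ≤ T ⊔ U) (h𝓕.1.2.1 F hF U hU) hlt'
        exact hTU ((le_inf hTF le_sup_left).trans (this.symm.le.trans inf_le_right))
      · refine Or.inr ⟨h𝓕.1.1 hF, ?_⟩
        rw [← hMeq U hU hTU, hMeq F hF hTF]
        exact le_sup_right

/-- A maximum family is one of the two examples, or small. -/
lemma IsMaximumNontrivialIntersecting.structure (hBa : B.IsAlt) (hB : B.Nondegenerate)
    (hdim : finrank K V = 2 * ν) {𝓕 : Set (Submodule K V)}
    (h𝓕 : IsMaximumNontrivialIntersecting B m t 𝓕) (ht : 1 ≤ t) (htm : t + 1 ≤ m) (htν : t ≤ ν)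
    (hlt : qInt (Nat.card K) (t + 1) * isoCount (Nat.card K) ν m (t + 2) <
      isoCount (Nat.card K) ν m (t + 1)) :
    (∃ Z ∈ isotropicSubspaces B (t + 2), 𝓕 = familyH₂ B m t Z) ∨
    (∃ T ∈ isotropicSubspaces B t, ∃ U ∈ isotropicSubspaces B m,
      T ⊔ U ∈ isotropicSubspaces B (m + 1) ∧ 𝓕 = familyH₁ B m t T U) ∨
    𝓕.ncard ≤ qInt (Nat.card K) (m - t) * isoCount (Nat.card K) ν m (t + 1) +
      (1 + qInt (Nat.card K) (t + 1)) * (qInt (Nat.card K) (m - t + 1) *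
        (qInt (Nat.card K) (m - t + 1) * isoCount (Nat.card K) ν m (t + 2))) ∨
    ∃ j, 2 ≤ j ∧ t + j ≤ m ∧ 𝓕.ncard ≤ (2 * Nat.card K ^ t) ^ j *
      (qInt (Nat.card K) (m - t + 1) ^ j * isoCount (Nat.card K) ν m (t + j)) := by
  classical
  obtain ⟨F₀, hF₀⟩ := h𝓕.1.nonempty hBa hB hdim htν
  -- Any member is itself a totally isotropic cover, so a minimal one exists.
  have hex : ∃ s, ∃ S, IsTotallyIsotropic B S ∧ IsCover t 𝓕 S ∧ finrank K S = s :=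
    ⟨m, F₀, (h𝓕.1.1 hF₀).1, fun F hF => h𝓕.1.2.1 F hF F₀ hF₀, (h𝓕.1.1 hF₀).2⟩
  obtain ⟨S, hS, hSc, hSd⟩ := Nat.find_spec hex
  have hmin : ∀ R, IsTotallyIsotropic B R → IsCover t 𝓕 R → finrank K S ≤ finrank K R :=
    fun R hR hRc => hSd.le.trans (Nat.find_min' hex ⟨R, hR, hRc, rfl⟩)
  have hSm : finrank K S ≤ m := by
    rw [← (h𝓕.1.1 hF₀).2]
    exact hmin F₀ (h𝓕.1.1 hF₀).1 fun F hF => h𝓕.1.2.1 F hF F₀ hF₀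
  have hSt : t + 1 ≤ finrank K S := by
    have h1 := (hSc F₀ hF₀).trans (Submodule.finrank_mono (inf_le_right : F₀ ⊓ S ≤ S))
    by_contra! h2
    refine h𝓕.1.2.2 ⟨S, by omega, fun F hF => ?_⟩
    exact inf_eq_right.1 (Submodule.eq_of_le_of_finrank_le inf_le_right
      (by have := hSc F hF; omega))
  obtain ⟨j, hj⟩ := Nat.exists_eq_add_of_le (show t ≤ finrank K S by omega)
  by_cases hj2 : 2 ≤ j
  · refine Or.inr (Or.inr (Or.inr ⟨j, hj2, by omega, ?_⟩))
    exact ncard_le_of_min_isCover hBa hB hdim h𝓕.1.1 h𝓕.1.2.1 (by omega)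
      (fun R hR hRc => hj ▸ hmin R hR hRc) hSc hj
  · rcases h𝓕.structure_of_isCover hBa hB hdim ht htm hlt hS hSc (by omega) with h | h | h
    exacts [Or.inl h, Or.inr (Or.inl h), Or.inr (Or.inr (Or.inl h))]

end SymplecticPolar

/-! ### Sizes of the two examples -/

namespace SymplecticPolar
open Module

/-- A union bound refined by multiplicity: elements of `A₀` are counted at least `z` times too
often. -/
lemma ncard_add_mul_le_ncard_mul {α β : Type*} [Finite α] [Finite β] (A A₀ : Set α) (R : Set β)
    (rel : α → β → Prop) (z y : ℕ) (hA₀ : A₀ ⊆ A)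
    (hA : ∀ a ∈ A, 1 ≤ {r | r ∈ R ∧ rel a r}.ncard)
    (hz : ∀ a ∈ A₀, z + 1 ≤ {r | r ∈ R ∧ rel a r}.ncard)
    (hR : ∀ r ∈ R, {a | a ∈ A ∧ rel a r}.ncard ≤ y) : A.ncard + z * A₀.ncard ≤ R.ncard * y := by
  classical
  have := Fintype.ofFinite α
  have := Fintype.ofFinite β
  have h1 : ∀ a, {r | r ∈ R ∧ rel a r}.ncard = (Finset.bipartiteAbove rel R.toFinset a).card := by
    intro a
    rw [Set.ncard_eq_toFinset_card']
    congr 1; ext; simp [Finset.bipartiteAbove]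
  have h2 : ∀ r, {a | a ∈ A ∧ rel a r}.ncard = (Finset.bipartiteBelow rel A.toFinset r).card := by
    intro r
    rw [Set.ncard_eq_toFinset_card']
    congr 1; ext; simp [Finset.bipartiteBelow]
  calc A.ncard + z * A₀.ncard
      = ∑ a ∈ A.toFinset, (1 + if a ∈ A₀ then z else 0) := by
        rw [Finset.sum_add_distrib, ← Finset.sum_filter, Finset.sum_const, Finset.sum_const,
          Set.ncard_eq_toFinset_card', Set.ncard_eq_toFinset_card']
        have : A.toFinset.filter (· ∈ A₀) = A₀.toFinset := by
          ext a
          simpa using fun h => hA₀ h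
        rw [this]
        simp [mul_comm]
    _ ≤ ∑ a ∈ A.toFinset, (Finset.bipartiteAbove rel R.toFinset a).card := by
        refine Finset.sum_le_sum fun a ha => ?_
        rw [← h1]
        split_ifs with h
        · have := hz a h
          omega
        · simpa using hA a (by simpa using ha)
    _ = ∑ r ∈ R.toFinset, (Finset.bipartiteBelow rel A.toFinset r).card :=
        Finset.sum_card_bipartiteAbove_eq_sum_card_bipartiteBelow rel
    _ ≤ ∑ r ∈ R.toFinset, y := Finset.sum_le_sum fun r hr => by
        rw [← h2]
        exact hR r (by simpa using hr)
    _ = R.ncard * y := by rw [Finset.sum_const, smul_eq_mul, Set.ncard_eq_toFinset_card']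

variable {K V : Type*} [Field K] [AddCommGroup V] [Module K V] {B : LinearMap.BilinForm K V}
variable [FiniteDimensional K V] {ν m t : ℕ} [Finite K]

/-- If `𝓖` contains the members of `𝒫_m` that meet `M` exactly in a `d`-space through `T`, then
`𝓖` is large. -/
lemma ncard_between_mul_isoCount_le (hBa : B.IsAlt) (hB : B.Nondegenerate)
    (hdim : finrank K V = 2 * ν) {T M : Submodule K V} (hM : IsTotallyIsotropic B M) {d : ℕ}
    {𝓖 : Set (Submodule K V)}
    (h𝓖 : ∀ F ∈ isotropicSubspaces B m, F ⊓ M ∈ between T M d → F ∈ 𝓖) :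
    (between T M d).ncard * isoCount (Nat.card K) ν m d ≤ 𝓖.ncard +
      (between T M d).ncard * (qInt (Nat.card K) (finrank K M - d) *
        isoCount (Nat.card K) ν m (d + 1)) := by
  have := finite_submodule (K := K) (V := V)
  have h := mul_le_ncard_of_disjoint 𝓖 (between T M d) (fun F S => F ⊓ M = S)
    (isoCount (Nat.card K) ν m d -
      qInt (Nat.card K) (finrank K M - d) * isoCount (Nat.card K) ν m (d + 1))
    (fun F _ S _ S' _ h h' => h.symm.trans h') ?_
  -- Truncated subtraction is harmless here: the term moves to the other side of the inequality.
  · rw [Nat.mul_sub] at h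
    omega
  · intro S hS
    have h1 := isoCount_le_ncard_inf_eq_add (m := m) hBa hB hdim (hM.mono hS.2.1) hS.2.1
    rw [hS.2.2] at h1
    have h2 : {F | F ∈ isotropicSubspaces B m ∧ F ⊓ M = S} ⊆ {F | F ∈ 𝓖 ∧ F ⊓ M = S} := by
      rintro F ⟨hF, hFS⟩
      exact ⟨h𝓖 F hF (hFS ▸ hS), hFS⟩
    have h3 := Set.ncard_le_ncard h2 (Set.toFinite _)
    omega

lemma le_ncard_familyH₂ (hBa : B.IsAlt) (hB : B.Nondegenerate) (hdim : finrank K V = 2 * ν)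
    {Z : Submodule K V} (hZ : Z ∈ isotropicSubspaces B (t + 2)) :
    qInt (Nat.card K) (t + 2) * isoCount (Nat.card K) ν m (t + 1) ≤
      (familyH₂ B m t Z).ncard +
        qInt (Nat.card K) (t + 2) * isoCount (Nat.card K) ν m (t + 2) := by
  have h := ncard_between_mul_isoCount_le (T := ⊥) (m := m) (d := t + 1) hBa hB hdim hZ.1
    (𝓖 := familyH₂ B m t Z) fun F hF h => ⟨hF, h.2.2.ge⟩
  have h1 := ncard_between_hyperplane (n := t + 1) (bot_le : ⊥ ≤ Z) (by rw [hZ.2]; simp)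
  rw [finrank_bot, zero_add] at h1
  rwa [h1, hZ.2, show t + 2 - (t + 1) = 1 by omega, qInt_one, one_mul] at h

lemma ncard_familyH₂_le (hBa : B.IsAlt) (hB : B.Nondegenerate) (hdim : finrank K V = 2 * ν)
    {Z : Submodule K V} (hZ : Z ∈ isotropicSubspaces B (t + 2)) :
    (familyH₂ B m t Z).ncard ≤
      qInt (Nat.card K) (t + 2) * isoCount (Nat.card K) ν m (t + 1) := by
  have h1 := ncard_between_hyperplane (n := t + 1) (bot_le : ⊥ ≤ Z) (by rw [hZ.2]; simp)
  rw [finrank_bot, zero_add] at h1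
  rw [← h1]
  refine ncard_le_of_isCover (fun F hF => hF.2) fun S _ hS => ?_
  rw [← hS]
  exact ncard_subfamily_le hBa hB hdim (fun F hF => hF.1) S

lemma le_ncard_pencilFamily (hBa : B.IsAlt) (hB : B.Nondegenerate) (hdim : finrank K V = 2 * ν)
    {T M : Submodule K V} (hT : finrank K T = t) (hTM : T ≤ M) (htm : t ≤ m)
    (hM : M ∈ isotropicSubspaces B (m + 1)) :
    qInt (Nat.card K) (m - t + 1) * isoCount (Nat.card K) ν m (t + 1) ≤
      (pencilFamily B m t T M).ncard + qInt (Nat.card K) (m - t + 1) *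
        (qInt (Nat.card K) (m - t) * isoCount (Nat.card K) ν m (t + 2)) := by
  have h := ncard_between_mul_isoCount_le (T := T) (m := m) (d := t + 1) hBa hB hdim hM.1
    (𝓖 := pencilFamily B m t T M) fun F hF h => Or.inl ⟨hF, h.1.trans inf_le_left, h.2.2.ge⟩
  have h1 := ncard_between_succ hTM
  rw [hM.2, hT, show m + 1 - t = m - t + 1 by omega] at h1
  rwa [h1, hM.2, show m + 1 - (t + 1) = m - t by omega] at h

/-- The members of `𝒫_m` that contain `T` and meet `M` in dimension at least `t + 2`. -/
def deepFamily (B : LinearMap.BilinForm K V) (m t : ℕ) (T M : Submodule K V) :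
    Set (Submodule K V) :=
  {F | F ∈ isotropicSubspaces B m ∧ T ≤ F ∧ t + 2 ≤ finrank K (F ⊓ M : Submodule K V)}

/-- A deep member contains at least q+1 of the (t+1)-spaces between `T` and `M`, so the union bound
over them counts it `q` times too often. The last term bounds the members inside `M`. -/
lemma ncard_pencilFamily_le (hBa : B.IsAlt) (hB : B.Nondegenerate) (hdim : finrank K V = 2 * ν)
    {T M : Submodule K V} (hT : finrank K T = t) (hTM : T ≤ M) (htm : t ≤ m)
    (hM : M ∈ isotropicSubspaces B (m + 1)) :
    (pencilFamily B m t T M).ncard + Nat.card K * (deepFamily B m t T M).ncard ≤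
      qInt (Nat.card K) (m - t + 1) * isoCount (Nat.card K) ν m (t + 1) +
        qInt (Nat.card K) (m + 1) := by
  have := finite_submodule (K := K) (V := V)
  have h1 := ncard_between_succ hTM
  rw [hM.2, hT, show m + 1 - t = m - t + 1 by omega] at h1
  have hcount : ∀ F : Submodule K V, T ≤ F → {R | R ∈ between T M (t + 1) ∧ R ≤ F}.ncard =
      qInt (Nat.card K) (finrank K (F ⊓ M : Submodule K V) - t) := by
    intro F hTF
    have h2 := ncard_between_succ (le_inf hTF hTM)
    rw [hT] at h2
    rw [← h2]
    congr 1
    ext R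
    exact ⟨fun h => ⟨h.1.1, le_inf h.2 h.1.2.1, h.1.2.2⟩,
      fun h => ⟨⟨h.1, h.2.1.trans inf_le_right, h.2.2⟩, h.2.1.trans inf_le_left⟩⟩
  have h3 := ncard_add_mul_le_ncard_mul
    {F | F ∈ isotropicSubspaces B m ∧ T ≤ F ∧ t + 1 ≤ finrank K (F ⊓ M : Submodule K V)}
    (deepFamily B m t T M) (between T M (t + 1)) (fun F R => R ≤ F) (Nat.card K)
    (isoCount (Nat.card K) ν m (t + 1))
    (fun F hF => ⟨hF.1, hF.2.1, (Nat.le_succ _).trans hF.2.2⟩)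
    (fun F hF => by
      have := hF.2.2
      rw [hcount F hF.2.1]
      exact qInt_pos (by omega))
    (fun F hF => by
      have := hF.2.2
      rw [hcount F hF.2.1]
      refine le_trans ?_ (qInt_mono _ (show 2 ≤ finrank K (F ⊓ M : Submodule K V) - t by omega))
      rw [qInt_succ', qInt_one, mul_one])
    (fun R hR => by
      rw [← hR.2.2]
      exact ncard_subfamily_le hBa hB hdim (fun F hF => hF.1) R)
  have h4 : (isotropicIn B m M).ncard ≤ qInt (Nat.card K) (m + 1) := by
    have h5 := ncard_between_hyperplane (n := m) (bot_le : ⊥ ≤ M) (by rw [hM.2]; simp)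
    rw [finrank_bot, zero_add] at h5
    rw [← h5]
    exact Set.ncard_le_ncard (fun F hF => ⟨bot_le, hF.2, hF.1.2⟩) (Set.toFinite _)
  have h5 := Set.ncard_union_le {F | F ∈ isotropicSubspaces B m ∧ T ≤ F ∧
    t + 1 ≤ finrank K (F ⊓ M : Submodule K V)} (isotropicIn B m M)
  rw [h1] at h3
  rw [pencilFamily]
  omega

lemma le_ncard_deepFamily (hBa : B.IsAlt) (hB : B.Nondegenerate) (hdim : finrank K V = 2 * ν)
    {T M : Submodule K V} (hT : finrank K T = t) (hTM : T ≤ M) (htm : t + 1 ≤ m)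
    (hM : M ∈ isotropicSubspaces B (m + 1)) :
    qInt (Nat.card K) (m - t + 1) * qInt (Nat.card K) (m - t) *
        isoCount (Nat.card K) ν m (t + 2) ≤ (Nat.card K + 1) * (deepFamily B m t T M).ncard +
      qInt (Nat.card K) (m - t + 1) * qInt (Nat.card K) (m - t) *
        (qInt (Nat.card K) (m - t - 1) * isoCount (Nat.card K) ν m (t + 3)) := by
  have h := ncard_between_mul_isoCount_le (T := T) (m := m) (d := t + 2) hBa hB hdim hM.1
    (𝓖 := deepFamily B m t T M) fun F hF h => ⟨hF, h.1.trans inf_le_left, h.2.2.ge⟩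
  have h1 := ncard_between_two hTM (n := m - t) (by rw [hM.2, hT]; omega)
  rw [hT] at h1
  rw [hM.2, show m + 1 - (t + 2) = m - t - 1 by omega, show t + 2 + 1 = t + 3 from rfl] at h
  rw [← h1]
  have := Nat.mul_le_mul_left (Nat.card K + 1) h
  rw [mul_add] at this
  refine le_trans (le_of_eq ?_) (this.trans (le_of_eq ?_)) <;> ring

end SymplecticPolar

/-! ### Numerical comparison -/

namespace SymplecticPolar
open Module

section Estimates

variable {q t x : ℕ}

lemma qInt_succ_le (hq : 2 ≤ q) (n : ℕ) : qInt q (n + 1) ≤ 2 * q ^ n := (qInt_succ_lt hq n).le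

/-- The members that avoid the pencil of covers contribute little. -/
lemma error_term_le (hq : 2 ≤ q) (D : ℕ) :
    (1 + qInt q (t + 1)) * (qInt q (x + 1) * (qInt q (x + 1) * D)) ≤
      8 * (q ^ (t + 2 * x) * D) := by
  have h1 : 1 + qInt q (t + 1) ≤ 2 * q ^ t := by
    have := qInt_succ_lt hq t
    omega
  have h2 := qInt_succ_le hq x
  calc _ ≤ 2 * q ^ t * (2 * q ^ x * (2 * q ^ x * D)) := by gcongr
    _ = _ := by rw [pow_add, two_mul x, pow_add]; ring

lemma pow_mul_le_of_le {a b D C : ℕ} (hq : 2 ≤ q) (h : q ^ b * D ≤ C) (hab : a ≤ b) :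
    q ^ a * D ≤ C :=
  (Nat.mul_le_mul_right _ (Nat.pow_le_pow_right (by omega) hab)).trans h

/-- The worst case is j = 2: each further step costs a factor 4q^m but gains at least q^(m+2) ≥
4q^m, which is where 3m+2 enters. -/
lemma iterated_bound_le {m n : ℕ} (hq : 2 ≤ q) (htm : t + x = m) (c : ℕ → ℕ)
    (hc : ∀ k, q ^ (n - m - k) * c (k + 1) ≤ c k) (hn : 3 * m + 2 ≤ n) {j : ℕ} (hj : 2 ≤ j)
    (hjm : t + j ≤ m) :
    (2 * q ^ t) ^ j * (qInt q (x + 1) ^ j * c (t + j)) ≤ 16 * q ^ (2 * m) * c (t + 2) := by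
  have h1 : (2 * q ^ t) ^ j * (qInt q (x + 1) ^ j * c (t + j)) ≤ (4 * q ^ m) ^ j * c (t + j) := by
    calc _ ≤ (2 * q ^ t) ^ j * ((2 * q ^ x) ^ j * c (t + j)) := by
          gcongr
          exact qInt_succ_le hq x
      _ = _ := by rw [← mul_assoc, ← mul_pow, ← htm, pow_add]; ring
  refine h1.trans ?_
  have h2 : ∀ i, t + (2 + i) ≤ m → (4 * q ^ m) ^ (2 + i) * c (t + (2 + i)) ≤
      (4 * q ^ m) ^ 2 * c (t + 2) := by
    intro i
    induction i with
    | zero => simp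
    | succ i ih =>
      intro hi
      refine le_trans ?_ (ih (by omega))
      rw [show 2 + (i + 1) = (2 + i) + 1 by ring, pow_succ, mul_assoc]
      refine Nat.mul_le_mul_left _ ?_
      have h3 := pow_mul_le_of_le hq (hc (t + (2 + i))) (show m + 2 ≤ _ by omega)
      refine le_trans ?_ h3
      rw [show t + (2 + i + 1) = t + (2 + i) + 1 by ring]
      refine Nat.mul_le_mul_right _ ?_
      rw [pow_add, mul_comm]
      exact Nat.mul_le_mul_left _ (by nlinarith)
  obtain ⟨i, rfl⟩ := Nat.exists_eq_add_of_le hj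
  refine (h2 i hjm).trans (le_of_eq ?_)
  rw [mul_pow, ← pow_mul, mul_comm m 2]
  norm_num

lemma two_mul_pow_mul_le {m e M C D : ℕ} (hq : 2 ≤ q) (h : q ^ e * D ≤ C)
    (hM : 2 * m + 5 ≤ e + M) : 2 * (16 * q ^ (2 * m) * D) ≤ q ^ M * C := by
  calc 2 * (16 * q ^ (2 * m) * D) = q ^ (2 * m) * 2 ^ 5 * D := by ring
    _ ≤ q ^ (2 * m) * q ^ 5 * D := by gcongr
    _ = q ^ (2 * m + 5) * D := by rw [pow_add]
    _ ≤ q ^ (e + M) * D := by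
        gcongr
        omega
    _ = q ^ M * (q ^ e * D) := by rw [pow_add]; ring
    _ ≤ _ := by gcongr

/-- The pencil example nearly attains its trivial upper bound. -/
lemma qInt_mul_le_add_of_pencil {C D P : ℕ} (hq : 2 ≤ q)
    (hP : qInt q (x + 1) * C ≤ P + qInt q (x + 1) * (qInt q x * D))
    (hD : q ^ (2 * x + 1) * D ≤ C) : qInt q (x + 1) * C ≤ P + C := by
  refine hP.trans (Nat.add_le_add_left (le_trans ?_ hD) _)
  calc _ ≤ 2 * q ^ x * (q ^ x * D) := by
        gcongr
        exacts [qInt_succ_le hq x, (qInt_lt_pow hq x).le]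
    _ ≤ q * q ^ x * (q ^ x * D) := by gcongr
    _ = _ := by rw [pow_succ, two_mul, pow_add]; ring

lemma qInt_mul_le_add_of_ball {C D P : ℕ} (hq : 2 ≤ q)
    (hP : qInt q (t + 2) * C ≤ P + qInt q (t + 2) * D)
    (hD : q ^ (t + 2) * D ≤ C) : qInt q (t + 2) * C ≤ P + C :=
  hP.trans (Nat.add_le_add_left
    ((Nat.mul_le_mul_right _ (qInt_lt_pow hq _).le).trans hD) _)

/-- Comparison of the two examples when their leading terms agree. -/
lemma lt_of_deep {D E A H P C : ℕ} (hq : 2 ≤ q) (ht : 2 ≤ t)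
    (hP : P + q * A ≤ qInt q (t + 2) * C + qInt q (2 * t + 2))
    (hA : qInt q (t + 2) * qInt q (t + 1) * D ≤
      (q + 1) * A + qInt q (t + 2) * qInt q (t + 1) * (qInt q t * E))
    (hH : qInt q (t + 2) * C ≤ H + qInt q (t + 2) * D)
    (hE : q ^ (t + 1) * E ≤ D) (hD : q ^ (2 * t + 2) ≤ D) : P < H := by
  have h1 : 2 * (qInt q t * E) ≤ D := by
    refine le_trans ?_ hE
    have := (qInt_lt_pow hq t).le
    calc 2 * (qInt q t * E) ≤ q * (q ^ t * E) := by gcongr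
      _ = _ := by rw [pow_succ]; ring
  -- Here t ≥ 2 is essential, through [t+1] ≥ q²+q+1.
  have h2 : 4 * (q + 1) ≤ q * qInt q (t + 1) := by
    have h3 := qInt_mono q (show 3 ≤ t + 1 by omega)
    have h4 : qInt q 3 = q * (q + 1) + 1 := by
      rw [qInt_succ', qInt_succ', qInt_one, mul_one]
    have h5 := Nat.mul_le_mul_left q h3
    rw [h4] at h5
    refine le_trans ?_ h5
    nlinarith [Nat.mul_le_mul hq hq]
  have h6 := qInt_lt_pow hq (2 * t + 2)
  have h7 : 1 ≤ qInt q (t + 2) := qInt_pos (by omega)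
  set G := qInt q (t + 2)
  set G' := qInt q (t + 1)
  have h8 : G * G' * D ≤ 2 * ((q + 1) * A) := by
    have := Nat.mul_le_mul_left (G * G') h1
    linarith
  have h9 : 4 * (q + 1) * (G * D) ≤ 2 * (q + 1) * (q * A) := by
    calc _ ≤ q * G' * (G * D) := by gcongr
      _ = q * (G * G' * D) := by ring
      _ ≤ q * (2 * ((q + 1) * A)) := by gcongr
      _ = _ := by ring
  have h10 : 2 * (G * D) ≤ q * A := by
    refine Nat.le_of_mul_le_mul_left (c := 2 * (q + 1)) (le_trans (le_of_eq ?_) h9) (by positivity)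
    ring
  have h11 : D ≤ G * D := Nat.le_mul_of_pos_left _ h7
  -- The gain qA ≥ 2GD exceeds the loss GD of ℋ₂ plus the term [2t+2] < D.
  omega

end Estimates

/-! ### Maximum families in the three parameter ranges -/

variable {K V : Type*} [Field K] [AddCommGroup V] [Module K V] {B : LinearMap.BilinForm K V}
variable [FiniteDimensional K V] {ν m t : ℕ}

/-- The members are themselves (t+1)-spaces pairwise meeting in dimension at least `t`, so the
configuration lemma applies to the family directly. -/
lemma IsMaximumNontrivialIntersecting.eq_familyH₂_of_succ (hBa : B.IsAlt) (hB : B.Nondegenerate)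
    (hdim : finrank K V = 2 * ν) [Finite K] {𝓕 : Set (Submodule K V)}
    (h𝓕 : IsMaximumNontrivialIntersecting B (t + 1) t 𝓕) (ht : 1 ≤ t) (htν : t ≤ ν) :
    ∃ Z ∈ isotropicSubspaces B (t + 2), 𝓕 = familyH₂ B (t + 1) t Z := by
  obtain ⟨Z, hZ, hX⟩ := exists_isotropic_of_pairwise hBa (h𝓕.1.nonempty hBa hB hdim htν) h𝓕.1.1
    h𝓕.1.2.1 h𝓕.1.2.2
  refine ⟨Z, hZ, h𝓕.eq_of_subset (isNontrivialIntersecting_familyH₂ hBa hB hdim ht ?_ hZ)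
    fun F hF => ⟨h𝓕.1.1 hF, hX F fun S hS => h𝓕.1.2.1 F hF S hS⟩⟩
  rw [isoCount_of_lt (by omega), isoCount_self]
  exact one_pos

variable [Finite K]

/-- For `2t + 2 ≤ m` every maximum family is of the first kind. -/
lemma IsMaximumNontrivialIntersecting.eq_familyH₁ (hBa : B.IsAlt) (hB : B.Nondegenerate)
    (hdim : finrank K V = 2 * ν) {𝓕 : Set (Submodule K V)}
    (h𝓕 : IsMaximumNontrivialIntersecting B m t 𝓕) (ht : 1 ≤ t) (htm : 2 * t + 2 ≤ m)
    (hν : 3 * m + 2 ≤ 2 * ν) (hν' : 2 * m + 2 * t + 6 ≤ 2 * ν) :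
    ∃ T ∈ isotropicSubspaces B t, ∃ U ∈ isotropicSubspaces B m,
      T ⊔ U ∈ isotropicSubspaces B (m + 1) ∧ 𝓕 = familyH₁ B m t T U := by
  obtain ⟨x, rfl⟩ := Nat.exists_eq_add_of_le (show t ≤ m by omega)
  have hq : 2 ≤ Nat.card K := Finite.one_lt_card
  have hc := pow_mul_isoCount_succ_le hBa hB hdim (show t + x ≤ ν by omega)
  have hCpos := isoCount_pos hBa hB hdim (show t + x ≤ ν by omega) (show t + 1 ≤ t + x by omega)
  obtain ⟨M, hM⟩ := exists_isotropic hBa hB hdim (show t + x + 1 ≤ ν by omega)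
  obtain ⟨T, -, hTM, hT⟩ := exists_between (bot_le : ⊥ ≤ M) (d := t) (by simp)
    (by rw [hM.2]; omega)
  have hP := le_ncard_pencilFamily hBa hB hdim hT hTM (by omega) hM
  have hPF := h𝓕.2 _ (isNontrivialIntersecting_pencilFamily ht (by omega) hT hM)
  set q := Nat.card K
  set C := isoCount q ν (t + x) (t + 1)
  set D := isoCount q ν (t + x) (t + 2)
  have hCD : q ^ (2 * ν - (t + x) - (t + 1)) * D ≤ C := hc (t + 1)
  rw [Nat.add_sub_cancel_left] at hP
  -- So a maximum family has at least ([x] + q^x - 1)C members; each alternative other than ℋ₁ falls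
  -- below this.
  have hP' := qInt_mul_le_add_of_pencil hq hP (pow_mul_le_of_le hq hCD (by omega))
  have hlt : qInt q (t + 1) * D < C := by
    have hDpos : 0 < D :=
      isoCount_pos hBa hB hdim (show t + x ≤ ν by omega) (show t + 2 ≤ t + x by omega)
    exact lt_of_lt_of_le (Nat.mul_lt_mul_of_pos_right (qInt_lt_pow hq _) hDpos)
      (pow_mul_le_of_le hq hCD (show t + 1 ≤ _ by omega))
  have hx8 : 8 ≤ q ^ x := by
    calc 8 = 2 ^ 3 := by norm_num
      _ ≤ q ^ 3 := by gcongr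
      _ ≤ q ^ x := Nat.pow_le_pow_right (by omega) (by omega)
  have hxs := qInt_succ q x
  have hx1 : 1 ≤ qInt q x := qInt_pos (by omega)
  rcases h𝓕.structure hBa hB hdim ht (by omega) (by omega) hlt with
    ⟨Z, hZ, h⟩ | h | h | ⟨j, hj, hjm, h⟩
  · exfalso
    have h1 := ncard_familyH₂_le (m := t + x) hBa hB hdim hZ
    rw [← h] at h1
    have h2 := qInt_mono q (show t + 2 ≤ x by omega)
    have h3 := Nat.mul_le_mul_right C h2
    rw [hxs] at hP'
    nlinarith
  · exact h
  · exfalso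
    rw [Nat.add_sub_cancel_left] at h
    have h1 := error_term_le (t := t) (x := x) hq D
    have h2 := pow_mul_le_of_le hq hCD (show t + 2 * x + 1 ≤ _ by omega)
    have h3 : 2 * (q ^ (t + 2 * x) * D) ≤ C := by
      refine le_trans ?_ h2
      rw [pow_succ, mul_comm _ q, mul_assoc]
      exact Nat.mul_le_mul_right _ hq
    rw [hxs] at hP'
    nlinarith
  · exfalso
    rw [Nat.add_sub_cancel_left] at h
    have h1 := iterated_bound_le hq rfl _ hc hν hj hjm
    -- The exponent condition here is exactly 2ν ≥ 2m+2t+6.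
    have h2 := two_mul_pow_mul_le (m := t + x) (M := x) hq hCD (by omega)
    rw [hxs] at hP'
    nlinarith

/-- For `m ≤ 2t + 1` every maximum family is of the second kind, except possibly if `m = 3` and
`t = 1`. -/
lemma IsMaximumNontrivialIntersecting.eq_familyH₂ (hBa : B.IsAlt) (hB : B.Nondegenerate)
    (hdim : finrank K V = 2 * ν) {𝓕 : Set (Submodule K V)}
    (h𝓕 : IsMaximumNontrivialIntersecting B m t 𝓕) (ht : 1 ≤ t) (htm : t + 2 ≤ m)
    (htm' : m ≤ 2 * t + 1) (hν : 3 * m + 2 ≤ 2 * ν) (hν' : 2 * m + 2 * t + 6 ≤ 2 * ν) :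
    (∃ Z ∈ isotropicSubspaces B (t + 2), 𝓕 = familyH₂ B m t Z) ∨ (m = 3 ∧ t = 1) ∧
    ∃ T ∈ isotropicSubspaces B t, ∃ U ∈ isotropicSubspaces B m,
      T ⊔ U ∈ isotropicSubspaces B (m + 1) ∧ 𝓕 = familyH₁ B m t T U := by
  obtain ⟨x, rfl⟩ := Nat.exists_eq_add_of_le (show t ≤ m by omega)
  have hq : 2 ≤ Nat.card K := Finite.one_lt_card
  have hc := pow_mul_isoCount_succ_le hBa hB hdim (show t + x ≤ ν by omega)
  have hDpos := isoCount_pos hBa hB hdim (show t + x ≤ ν by omega) (show t + 2 ≤ t + x by omega)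
  have hEpos := fun h => isoCount_pos hBa hB hdim (show t + x ≤ ν by omega)
    (k := t + 3) (show t + 3 ≤ t + x from h)
  obtain ⟨Z, hZ⟩ := exists_isotropic hBa hB hdim (show t + 2 ≤ ν by omega)
  have hH := le_ncard_familyH₂ (m := t + x) hBa hB hdim hZ
  set q := Nat.card K
  set C := isoCount q ν (t + x) (t + 1)
  set D := isoCount q ν (t + x) (t + 2)
  have hCD : q ^ (2 * ν - (t + x) - (t + 1)) * D ≤ C := hc (t + 1)
  have hlt : qInt q (t + 1) * D < C :=
    lt_of_lt_of_le (Nat.mul_lt_mul_of_pos_right (qInt_lt_pow hq _) hDpos)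
      (pow_mul_le_of_le hq hCD (show t + 1 ≤ _ by omega))
  have hCpos : 0 < C := by omega
  have hHF := h𝓕.2 _ (isNontrivialIntersecting_familyH₂ (Z := Z) hBa hB hdim ht
    ((Nat.le_mul_of_pos_left _ (qInt_pos (Nat.succ_pos t))).trans_lt hlt) hZ)
  have hH' := qInt_mul_le_add_of_ball hq hH (pow_mul_le_of_le hq hCD (by omega))
  have ht4 : 4 ≤ q ^ (t + 1) := by
    calc 4 = 2 ^ 2 := by norm_num
      _ ≤ q ^ 2 := by gcongr
      _ ≤ q ^ (t + 1) := Nat.pow_le_pow_right (by omega) (by omega)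
  have hts : qInt q (t + 2) = qInt q (t + 1) + q ^ (t + 1) := qInt_succ q (t + 1)
  have ht1 : 1 ≤ qInt q (t + 1) := qInt_pos (by omega)
  rcases h𝓕.structure hBa hB hdim ht (by omega) (by omega) hlt with
    h | ⟨T, hT, U, hU, hTU, h⟩ | h | ⟨j, hj, hjm, h⟩
  · exact Or.inl h
  · by_cases hex : t + x = 3 ∧ t = 1
    · exact Or.inr ⟨hex, T, hT, U, hU, hTU, h⟩
    exfalso
    have h1 := ncard_pencilFamily_le hBa hB hdim hT.2 (le_sup_left : T ≤ T ⊔ U) (by omega) hTU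
    rw [← familyH₁_eq_pencilFamily hU.2 hTU.2, ← h, Nat.add_sub_cancel_left] at h1
    -- For m ≤ 2t the leading terms already differ; m = 2t+1 is the tie, with t ≥ 2 because (3,1) is
    -- set aside.
    rcases Nat.lt_or_ge x (t + 1) with hx | hx
    · have h2 := qInt_mono q (show x + 1 ≤ t + 1 by omega)
      have h3 := Nat.mul_le_mul_right C h2
      have h4 : qInt q (t + x + 1) ≤ C := by
        refine (qInt_lt_pow hq _).le.trans (le_trans ?_
          (pow_mul_le_of_le hq hCD (show t + x + 1 ≤ _ by omega)))
        exact Nat.le_mul_of_pos_right _ hDpos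
      rw [hts] at hH'
      have h5 := Nat.zero_le (q * (deepFamily B (t + x) t T (T ⊔ U)).ncard)
      nlinarith
    · obtain rfl : x = t + 1 := by omega
      have h2 := le_ncard_deepFamily hBa hB hdim hT.2 (le_sup_left : T ≤ T ⊔ U) (by omega) hTU
      rw [Nat.add_sub_cancel_left, Nat.add_sub_cancel] at h2
      have hE := hc (t + 2)
      have := lt_of_deep (t := t) hq (by omega)
        (by rwa [show t + (t + 1) + 1 = 2 * t + 2 by ring] at h1) h2 hH
        (pow_mul_le_of_le hq hE (by omega))
        ((Nat.le_mul_of_pos_right _ (hEpos (by omega))).trans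
          (pow_mul_le_of_le hq hE (by omega)))
      omega
  · exfalso
    rw [Nat.add_sub_cancel_left] at h
    have h1 := error_term_le (t := t) (x := x) hq D
    have h2 := pow_mul_le_of_le hq hCD (show t + 2 * x + 3 ≤ _ by omega)
    have h3 : 8 * (q ^ (t + 2 * x) * D) ≤ C := by
      refine le_trans ?_ h2
      rw [pow_add q (t + 2 * x) 3, mul_comm _ (q ^ 3), mul_assoc]
      exact Nat.mul_le_mul_right _ (show 2 ^ 3 ≤ q ^ 3 by gcongr)
    have h4 := Nat.mul_le_mul_right C (qInt_mono q (show x ≤ t + 1 by omega))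
    rw [hts] at hH'
    nlinarith
  · exfalso
    rw [Nat.add_sub_cancel_left] at h
    have h1 := iterated_bound_le hq rfl _ hc hν hj hjm
    have h2 := two_mul_pow_mul_le (m := t + x) (M := t + 1) hq hCD (by omega)
    rw [hts] at hH'
    nlinarith

end SymplecticPolar

/-! ### The theorem -/

theorem theorem1p1 {K V : Type*} [Field K] [Finite K] [AddCommGroup V] [Module K V]
    [FiniteDimensional K V] (B : LinearMap.BilinForm K V) (hBalt : B.IsAlt)
    (hBnd : B.Nondegenerate) (ν m t : ℕ) (hdim : Module.finrank K V = 2 * ν)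
    (hpar : (ν ≥ m + 1 ∧ m + 1 = t + 2) ∨
      (2 * ν ≥ max (3 * m + 2) (2 * m + 2 * t + 6) ∧ m ≥ t + 2))
    (𝓕 : Set (Submodule K V))
    (h𝓕 : SymplecticPolar.IsMaximumNontrivialIntersecting B m t 𝓕) :
    (1 ≤ t ∧ (t : ℚ) ≤ (m : ℚ) / 2 - 1 →
      ∃ T ∈ SymplecticPolar.isotropicSubspaces B t,
        ∃ U ∈ SymplecticPolar.isotropicSubspaces B m,
          T ⊔ U ∈ SymplecticPolar.isotropicSubspaces B (m + 1) ∧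
            𝓕 = SymplecticPolar.familyH₁ B m t T U) ∧
    ((m : ℚ) / 2 - 1 < (t : ℚ) ∧ (t : ℚ) ≤ (m : ℚ) - 1 →
      (∃ Z ∈ SymplecticPolar.isotropicSubspaces B (t + 2),
        𝓕 = SymplecticPolar.familyH₂ B m t Z) ∨
      ((m = 3 ∧ t = 1) ∧
        ∃ T ∈ SymplecticPolar.isotropicSubspaces B 1,
          ∃ U ∈ SymplecticPolar.isotropicSubspaces B 3,
            T ⊔ U ∈ SymplecticPolar.isotropicSubspaces B 4 ∧
              𝓕 = SymplecticPolar.familyH₁ B m t T U)) := by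
  open SymplecticPolar in
  rcases Nat.eq_zero_or_pos t with rfl | ht
  -- For t = 0 the zero subspace makes every family trivial.
  · exact absurd ⟨⊥, by simp, fun F _ => bot_le⟩ h𝓕.1.2.2
  have e1 : (t : ℚ) ≤ (m : ℚ) / 2 - 1 ↔ 2 * t + 2 ≤ m := by
    rw [← Nat.cast_le (α := ℚ)]
    push_cast
    constructor <;> intro h <;> linarith
  rw [← not_le, e1]
  rcases hpar with ⟨hν, hm⟩ | ⟨hν, hm⟩
  · obtain rfl : m = t + 1 := by omega
    exact ⟨fun h => by omega, fun _ =>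
      Or.inl (h𝓕.eq_familyH₂_of_succ hBalt hBnd hdim ht (by omega))⟩
  · rw [ge_iff_le, max_le_iff] at hν
    refine ⟨fun h => h𝓕.eq_familyH₁ hBalt hBnd hdim ht h.2 hν.1 hν.2, fun h => ?_⟩
    rcases h𝓕.eq_familyH₂ hBalt hBnd hdim ht hm (by omega) hν.1 hν.2 with h | ⟨⟨rfl, rfl⟩, h⟩
    · exact Or.inl h
    · exact Or.inr ⟨⟨rfl, rfl⟩, h⟩
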